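/- Let $\mathfrak{g}$ be a finite-dimensional simple Lie algebra over $\mathbb{C}$, let $\mathfrak{h}$ be a Cartan subalgebra with set of roots $\Delta$ and root spaces $\mathfrak{g}_\alpha$, and let $\langle\cdot,\cdot\rangle$ be the Killing form normalized so that the longest roots have squared length $2$. Let $\hat{\mathfrak{g}}=\mathfrak{g}\otimes\mathbb{C}[t,t^{-1}]\oplus\mathbb{C}\mathbf{k}$ be the affine Lie algebra in which $\mathbf{k}$ is central and $$[a\otimes t^m,b\otimes t^n]=[a,b]\otimes t^{m+n}+m\langle a,b\rangle\delta_{m+n,0}\mathbf{k}\qquad(a,b\in\mathfrak{g},\ m,n\in\mathbb{Z}).$$ On a $\hat{\mathfrak{g}}$-module $W$ write $a(n)$ for the action of $a\otimes t^n$, and put $a(x)w=\sum_{n\in\mathbb{Z}}(a(n)w)x^{-n-1}\in W[[x,x^{-1}]]$. The module $W$ is *integrable* if for all $\alpha\in\Delta$, $a\in\mathfrak{g}_\alpha$ and $n\in\mathbb{Z}$ the operator $a(n)$ is locally nilpotent on $W$. It belongs to the *category $\mathcal{E}$* if there is a nonzero polynomial $p(x)\in\mathbb{C}[x]$ such that $p(x)a(x)w=0$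 for all $a\in\mathfrak{g}$ and $w\in W$. For $\mathfrak{g}$-modules $U_1,\dots,U_r$ and nonzero $z_1,\dots,z_r\in\mathbb{C}$, the *evaluation module* $U_1(z_1)\otimes\cdots\otimes U_r(z_r)$ is the vector space $U_1\otimes\cdots\otimes U_r$ on which $\mathbf{k}$ acts as $0$ and $$a(n)(u_1\otimes\cdots\otimes u_r)=\sum_{i=1}^r z_i^n\,(u_1\otimes\cdots\otimes au_i\otimes\cdots\otimes u_r).$$ **Proposition.** A $\hat{\mathfrak{g}}$-module $W$ is irreducible, integrable and in the category $\mathcal{E}$ if and only if it is isomorphic to an evaluation module $U_1(z_1)\otimes\cdots\otimes U_r(z_r)$ for some $r\ge 1$, some finite-dimensional irreducible $\mathfrak{g}$-modules $U_1,\dots,U_r$ and some distinct nonzero complex numbers $z_1,\dots,z_r$. -/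

import Mathlib

open scoped TensorProduct

noncomputable section

namespace AffineLie

section Affine

variable {𝔤 : Type*} [LieRing 𝔤] [LieAlgebra ℂ 𝔤]

/-- The affine Lie algebra `𝔤 ⊗ ℂ[t, t⁻¹] ⊕ ℂ k` of a Lie algebra `𝔤` with a symmetric invariant
bilinear form `Φ`: the central extension of the loop algebra by the cocycle
`(a ⊗ tᵐ, b ⊗ tⁿ) ↦ m Φ(a, b) δ_{m+n,0}`. Mathlib's cocycle is `(f, g) ↦ Res (f dg)`, which is
`n Φ(a, b) δ_{m+n,0}` on these elements; this explains the sign. -/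
abbrev Affine (Φ : LinearMap.BilinForm ℂ 𝔤) (hΦ : Φ.lieInvariant 𝔤) (hΦs : Φ.IsSymm) : Type _ :=
  LieAlgebra.ofTwoCocycle
    ((-1 : ℂ) • LieAlgebra.LoopAlgebra.twoCocycleOfBilinear ℂ ℤ 𝔤 Φ hΦ hΦs)

variable (Φ : LinearMap.BilinForm ℂ 𝔤) (hΦ : Φ.lieInvariant 𝔤) (hΦs : Φ.IsSymm)

/-- The element `a ⊗ tⁿ` of the affine Lie algebra. -/
def loopElt (a : 𝔤) (n : ℤ) : Affine Φ hΦ hΦs :=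
  LieAlgebra.ofProd _ (AddMonoidAlgebra.single n (1 : ℂ) ⊗ₜ[ℂ] a, 0)

/-- The central element `k` of the affine Lie algebra. -/
def central : Affine Φ hΦ hΦs :=
  LieAlgebra.ofProd _
    (0, (TrivialLieModule.equiv ℂ (LieAlgebra.loopAlgebra ℂ ℤ 𝔤) ℂ).symm 1)

/-- The defining commutation relations. -/
theorem loopElt_lie_loopElt (a b : 𝔤) (m n : ℤ) :
    ⁅loopElt Φ hΦ hΦs a m, loopElt Φ hΦ hΦs b n⁆ =
      loopElt Φ hΦ hΦs ⁅a, b⁆ (m + n) +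
        ((m : ℂ) * Φ a b * (if m + n = 0 then 1 else 0)) • central Φ hΦ hΦs := by
  have h : LieAlgebra.LoopAlgebra.residuePairing ℂ ℤ 𝔤 Φ
      (AddMonoidAlgebra.single m (1 : ℂ) ⊗ₜ[ℂ] a) (AddMonoidAlgebra.single n (1 : ℂ) ⊗ₜ[ℂ] b) =
      -((m : ℂ) * Φ a b * (if m + n = 0 then 1 else 0)) := by
    rw [LieAlgebra.LoopAlgebra.residuePairing_apply_apply,
      LieAlgebra.LoopAlgebra.toFinsupp_single_tmul, LieAlgebra.LoopAlgebra.toFinsupp_single_tmul,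
      Finsupp.sum_single_index (by simp)]
    by_cases hmn : m + n = 0
    · obtain rfl : n = -m := by omega
      simp
    · rw [Finsupp.single_eq_of_ne (by omega)]
      simp [hmn]
  refine (LieAlgebra.bracket_ofTwoCocycle _ _).trans ?_
  refine congrArg (LieAlgebra.ofProd _) (Prod.ext ?_ ?_)
  · change ⁅AddMonoidAlgebra.single m (1 : ℂ) ⊗ₜ[ℂ] a, AddMonoidAlgebra.single n (1 : ℂ) ⊗ₜ[ℂ] b⁆ =
      AddMonoidAlgebra.single (m + n) (1 : ℂ) ⊗ₜ[ℂ] ⁅a, b⁆ + (_ : ℂ) • 0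
    rw [LieAlgebra.ExtendScalars.bracket_tmul, AddMonoidAlgebra.single_mul_single, mul_one,
      smul_zero, add_zero]
  · change (-1 : ℂ) • (TrivialLieModule.equiv ℂ (LieAlgebra.loopAlgebra ℂ ℤ 𝔤) ℂ).symm
        (LieAlgebra.LoopAlgebra.residuePairing ℂ ℤ 𝔤 Φ (AddMonoidAlgebra.single m (1 : ℂ) ⊗ₜ[ℂ] a)
          (AddMonoidAlgebra.single n (1 : ℂ) ⊗ₜ[ℂ] b)) + 0 - 0 =
      0 + (_ : ℂ) • (TrivialLieModule.equiv ℂ (LieAlgebra.loopAlgebra ℂ ℤ 𝔤) ℂ).symm 1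
    rw [h, sub_zero, add_zero, zero_add, ← map_smul, ← map_smul]
    congr 1
    simp only [smul_eq_mul]
    ring

/-- The central element is central. -/
theorem central_lie (x : Affine Φ hΦ hΦs) : ⁅central Φ hΦ hΦs, x⁆ = 0 := by
  refine (LieAlgebra.bracket_ofTwoCocycle _ _).trans ?_
  exact congrArg (LieAlgebra.ofProd _) (Prod.ext (by simp [central]) (by simp [central, trivial_lie_zero]))

/-- Evaluation of Laurent polynomials at a nonzero complex number, `tⁿ ↦ zⁿ`. -/
def evalLaurent (z : ℂˣ) : AddMonoidAlgebra ℂ ℤ →ₐ[ℂ] ℂ :=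
  AddMonoidAlgebra.lift ℂ ℂ ℤ ((Units.coeHom ℂ).comp (zpowersHom ℂˣ z))

theorem lid_lie (x y : ℂ ⊗[ℂ] 𝔤) :
    TensorProduct.lid ℂ 𝔤 ⁅x, y⁆ = ⁅TensorProduct.lid ℂ 𝔤 x, TensorProduct.lid ℂ 𝔤 y⁆ := by
  induction x using TensorProduct.induction_on with
  | zero => simp
  | add x₁ x₂ h₁ h₂ => rw [add_lie, map_add, h₁, h₂, map_add, add_lie]
  | tmul c a =>
    induction y using TensorProduct.induction_on with
    | zero =>
      have e : ⁅c ⊗ₜ[ℂ] a, (0 : ℂ ⊗[ℂ] 𝔤)⁆ = 0 :=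
        lie_zero (L := ℂ ⊗[ℂ] 𝔤) (M := ℂ ⊗[ℂ] 𝔤) _
      rw [e, map_zero, lie_zero]
    | add y₁ y₂ h₁ h₂ =>
      have e : ⁅c ⊗ₜ[ℂ] a, y₁ + y₂⁆ = ⁅c ⊗ₜ[ℂ] a, y₁⁆ + ⁅c ⊗ₜ[ℂ] a, y₂⁆ :=
        lie_add (L := ℂ ⊗[ℂ] 𝔤) (M := ℂ ⊗[ℂ] 𝔤) _ _ _
      rw [e, map_add, h₁, h₂, map_add, lie_add]
    | tmul d b => simp [smul_smul, mul_comm]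

/-- The evaluation homomorphism from the affine Lie algebra to `𝔤`:
`a ⊗ tⁿ ↦ zⁿ a` and `k ↦ 0`. -/
def evalHom (z : ℂˣ) : Affine Φ hΦ hΦs →ₗ⁅ℂ⁆ 𝔤 where
  toFun x := TensorProduct.lid ℂ 𝔤
    (LieAlgebra.ExtendScalars.map (evalLaurent z) (LieHom.id : 𝔤 →ₗ⁅ℂ⁆ 𝔤)
      ((LieAlgebra.ofProd _).symm x).1)
  map_add' x y := by
    simp
  map_smul' c x := by
    simp
  map_lie' {x y} := by
    simp [LieAlgebra.bracket_ofTwoCocycle, lid_lie]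

theorem evalHom_loopElt (z : ℂˣ) (a : 𝔤) (n : ℤ) :
    evalHom Φ hΦ hΦs z (loopElt Φ hΦ hΦs a n) = ((z : ℂ) ^ n) • a := by
  change evalLaurent z (AddMonoidAlgebra.single n (1 : ℂ)) • a = _
  rw [evalLaurent, AddMonoidAlgebra.lift_single]
  simp

theorem evalHom_central (z : ℂˣ) : evalHom Φ hΦ hΦs z (central Φ hΦ hΦs) = 0 := by
  simp [evalHom, central]

/-- For a `𝔤`-module `U` and a nonzero complex number `z`, the space `U(z)`: a copy of `U`, on which
the affine Lie algebra acts by `a(n) u = zⁿ (a u)` and `k u = 0`. -/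
def Eval (_z : ℂˣ) (U : Type*) : Type _ := U

section Eval

variable (z : ℂˣ) (U : Type*) [AddCommGroup U] [Module ℂ U] [LieRingModule 𝔤 U]
  [LieModule ℂ 𝔤 U]

instance : AddCommGroup (Eval z U) := inferInstanceAs (AddCommGroup U)

instance : Module ℂ (Eval z U) := inferInstanceAs (Module ℂ U)

instance : LieRingModule (Affine Φ hΦ hΦs) (Eval z U) :=
  LieRingModule.compLieHom U (evalHom Φ hΦ hΦs z)

instance : LieModule ℂ (Affine Φ hΦ hΦs) (Eval z U) :=
  LieModule.compLieHom U (evalHom Φ hΦ hΦs z)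

theorem loopElt_lie_eval (a : 𝔤) (n : ℤ) (u : U) :
    (⁅loopElt Φ hΦ hΦs a n, (u : Eval z U)⁆ : Eval z U) = (((z : ℂ) ^ n) • ⁅a, u⁆ : U) := by
  change ⁅evalHom Φ hΦ hΦs z (loopElt Φ hΦ hΦs a n), u⁆ = _
  rw [evalHom_loopElt, smul_lie]

end Eval

theorem central_lie_eval {z : ℂˣ} {U : Type*} [AddCommGroup U] [LieRingModule 𝔤 U]
    (u : Eval z U) : ⁅central Φ hΦ hΦs, u⁆ = 0 := by
  change (⁅evalHom Φ hΦ hΦs z (central Φ hΦ hΦs), (u : U)⁆ : U) = 0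
  rw [evalHom_central]
  exact zero_lie (M := U) u

end Affine

/-! ### Tensor products of finitely many Lie modules -/

section Tensor

variable {R ι : Type*} [CommRing R] [DecidableEq ι]
  (M : ι → Type*) [∀ i, AddCommGroup (M i)] [∀ i, Module R (M i)]

/-- `f` acting on the `i`-th tensor factor, the identity on the others. -/
def factorEnd (i : ι) (f : Module.End R (M i)) : Module.End R (⨂[R] j, M j) :=
  PiTensorProduct.map (Function.update (fun _ => LinearMap.id) i f)

theorem factorEnd_tprod (i : ι) (f : Module.End R (M i)) (u : ∀ j, M j) :
    factorEnd M i f (PiTensorProduct.tprod R u) =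
      PiTensorProduct.tprod R (Function.update u i (f (u i))) := by
  rw [factorEnd, PiTensorProduct.map_tprod]
  congr 1
  ext j
  by_cases h : j = i
  · subst h; simp
  · simp [h]

theorem factorEnd_add (i : ι) (f g : Module.End R (M i)) :
    factorEnd M i (f + g) = factorEnd M i f + factorEnd M i g :=
  PiTensorProduct.map_update_add _ i f g

theorem factorEnd_mul_same (i : ι) (f g : Module.End R (M i)) (m : ⨂[R] j, M j) :
    factorEnd M i f (factorEnd M i g m) = factorEnd M i (f * g) m := by
  change (factorEnd M i f ∘ₗ factorEnd M i g) m = _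
  congr 1
  ext u
  simp [factorEnd_tprod]

theorem factorEnd_comm {i j : ι} (h : i ≠ j) (f : Module.End R (M i)) (g : Module.End R (M j))
    (m : ⨂[R] j, M j) :
    factorEnd M i f (factorEnd M j g m) = factorEnd M j g (factorEnd M i f m) := by
  change (factorEnd M i f ∘ₗ factorEnd M j g) m = (factorEnd M j g ∘ₗ factorEnd M i f) m
  congr 1
  ext u
  simp [factorEnd_tprod, h, h.symm, Function.update_comm h]

variable {L : Type*} [LieRing L] [LieAlgebra R L] [Fintype ι]
  [∀ i, LieRingModule L (M i)] [∀ i, LieModule R L (M i)]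

/-- The operator `u₁ ⊗ ⋯ ⊗ uᵣ ↦ ∑ᵢ u₁ ⊗ ⋯ ⊗ x uᵢ ⊗ ⋯ ⊗ uᵣ` by which an element `x` of a Lie algebra
acts on a tensor product of finitely many modules. -/
def tensorAct (x : L) : Module.End R (⨂[R] j, M j) :=
  ∑ i, factorEnd M i (LieModule.toEnd R L (M i) x)

instance : LieRingModule L (⨂[R] j, M j) where
  bracket x m := tensorAct M x m
  add_lie x y m := by
    change tensorAct M (x + y) m = tensorAct M x m + tensorAct M y m
    simp [tensorAct, factorEnd, PiTensorProduct.map_update_add, Finset.sum_add_distrib]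
  lie_add x m n := map_add _ m n
  leibniz_lie x y m := by
    change tensorAct M x (tensorAct M y m) =
      tensorAct M ⁅x, y⁆ m + tensorAct M y (tensorAct M x m)
    have key : ∀ i j, factorEnd M i (LieModule.toEnd R L (M i) x)
        (factorEnd M j (LieModule.toEnd R L (M j) y) m) =
        (if i = j then factorEnd M i (LieModule.toEnd R L (M i) ⁅x, y⁆) m else 0) +
          factorEnd M j (LieModule.toEnd R L (M j) y)
            (factorEnd M i (LieModule.toEnd R L (M i) x) m) := by
      intro i j
      by_cases hij : i = j
      · subst hij
        simp only [if_true]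
        rw [factorEnd_mul_same, factorEnd_mul_same, ← LinearMap.add_apply, ← factorEnd_add]
        congr 2
        ext v
        simp
      · rw [if_neg hij, zero_add, factorEnd_comm M hij]
    simp only [tensorAct, LinearMap.sum_apply, map_sum, key, Finset.sum_add_distrib,
      Finset.sum_ite_eq', Finset.mem_univ, if_true]
    congr 1
    exact Finset.sum_comm

instance : LieModule R L (⨂[R] j, M j) where
  smul_lie c x m := by
    change tensorAct M (c • x) m = c • tensorAct M x m
    simp [tensorAct, factorEnd, PiTensorProduct.map_update_smul, Finset.smul_sum]
  lie_smul c x m := map_smul (tensorAct M x) c m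

theorem lie_tprod (x : L) (u : ∀ j, M j) :
    ⁅x, PiTensorProduct.tprod R u⁆ =
      ∑ i, PiTensorProduct.tprod R (Function.update u i ⁅x, u i⁆) := by
  change tensorAct M x _ = _
  simp [tensorAct, factorEnd_tprod]

end Tensor

/-! ### The normalized Killing form -/

section Normalized

variable {𝔤 : Type*} [LieRing 𝔤] [LieAlgebra ℂ 𝔤] [FiniteDimensional ℂ 𝔤] [LieAlgebra.IsSimple ℂ 𝔤]
  (H : LieSubalgebra ℂ 𝔤) [H.IsCartanSubalgebra]

/-- The squared length of a root `α` for the form on the dual of the Cartan subalgebra `H` induced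
by the Killing form `κ`: it is `α(t)`, where `t ∈ H` is given by `κ(t, h) = α(h)` for `h ∈ H`. It is
a positive rational number. -/
def rootSqLength (α : LieModule.Weight ℂ H 𝔤) : ℂ :=
  α ((LieAlgebra.IsKilling.cartanEquivDual H).symm α.toLinear)

/-- The squared length of the longest roots for the form induced by the Killing form. -/
def longSqLength : ℝ := ⨆ α : H.root, (rootSqLength H (α : LieModule.Weight ℂ H 𝔤)).re

/-- The multiple of the Killing form for which the longest roots have squared length `2`. (Squared
lengths of roots are divided by `c` when the form on the Lie algebra is multiplied by `c`.) -/
def normForm : LinearMap.BilinForm ℂ 𝔤 := ((longSqLength H / 2 : ℝ) : ℂ) • killingForm ℂ 𝔤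

theorem normForm_lieInvariant : (normForm H).lieInvariant 𝔤 := by
  intro x y z
  have h := LieModule.traceForm_lieInvariant ℂ 𝔤 𝔤 x y z
  simp only [normForm, LinearMap.smul_apply, h, smul_neg]

theorem normForm_isSymm : (normForm H).IsSymm := by
  refine ⟨fun x y => ?_⟩
  simp [normForm, LieModule.traceForm_comm ℂ 𝔤 𝔤 x y]

/-- The standard untwisted affine Lie algebra of a finite-dimensional simple Lie algebra. -/
abbrev StdAffine : Type _ := Affine (normForm H) (normForm_lieInvariant H) (normForm_isSymm H)

/-- The element `a(n) = a ⊗ tⁿ` of the standard affine Lie algebra. -/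
abbrev elt (a : 𝔤) (n : ℤ) : StdAffine H :=
  loopElt (normForm H) (normForm_lieInvariant H) (normForm_isSymm H) a n

variable (W : Type*) [AddCommGroup W] [Module ℂ W] [LieRingModule (StdAffine H) W]
  [LieModule ℂ (StdAffine H) W]

/-- A module is integrable if `a(n)` acts locally nilpotently for all root vectors `a ∈ 𝔤_α`, all
roots `α` and all `n ∈ ℤ`. -/
def IsIntegrable : Prop :=
  ∀ α ∈ H.root, ∀ a ∈ LieAlgebra.rootSpace H α, ∀ n : ℤ, ∀ w : W,
    ∃ k : ℕ, ((LieModule.toEnd ℂ (StdAffine H) W (elt H a n)) ^ k) w = 0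

/-- The doubly infinite formal series `a(x) w = ∑_{n ∈ ℤ} (a(n) w) x^{-n-1}` in `W[[x, x⁻¹]]`. A
series is given by its coefficients: the value at `j` is the coefficient of `x^j`. -/
def genFun (a : 𝔤) (w : W) : ℤ → W := fun j => ⁅elt H a (-j - 1), w⁆

variable {W} in
/-- The product of a polynomial and a doubly infinite formal series: its coefficient of `x^j` is
`∑_k p_k f_{j-k}`. -/
def polyMul (p : Polynomial ℂ) (f : ℤ → W) : ℤ → W :=
  fun j => p.sum fun k c => c • f (j - (k : ℤ))

/-- Membership in the category `ℰ`: there is a nonzero polynomial `p(x)` with `p(x) a(x) w = 0` for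
all `a ∈ 𝔤` and `w ∈ W`. -/
def InCategoryE : Prop :=
  ∃ p : Polynomial ℂ, p ≠ 0 ∧ ∀ (a : 𝔤) (w : W), polyMul p (genFun H W a w) = 0

end Normalized

end AffineLie

end

/-! Suppose `W` is irreducible, integrable and in `ℰ`. The condition `p(x)a(x) = 0` says that every
`a ⊗ tʲp(t)` acts as zero. Commuting these elements with some `b(n)` isolates the central term, so
`k` acts as zero and the action factors through `𝔤 ⊗ ℂ[t,t⁻¹]/(p)`, which is finite-dimensional.
Root vectors `e(n)` are locally nilpotent, and so is `exp(ad e(0)) f(n) = f(n) + h(n) - e(n)` for an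
`𝔰𝔩₂`-triple of root vectors. The finite-dimensional Lie algebra of operators is therefore spanned
by locally nilpotent ones; a straightening argument as in PBW puts each vector into a
finite-dimensional stable subspace, and irreducibility gives `dim W < ∞`.

A finite-dimensional Lie algebra acting faithfully and irreducibly has its radical equal to its
centre. Hence the ideal of Laurent polynomials `f` with `𝔤 ⊗ f` acting as zero is radical, and
contains some `∏ (t - zᵢ)` with distinct nonzero `zᵢ`. Lagrange interpolation splits the action into
commuting representations `ρᵢ` of `𝔤` with `a(n) = ∑ zᵢⁿ ρᵢ(a)`. Passing repeatedly to spaces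
`Hom_𝔤(U, -)` yields irreducible `Uᵢ` and a nonzero homomorphism from the evaluation module to `W`.
Both sides are irreducible, so it is an isomorphism.

Conversely, on an evaluation module at distinct points, `a ⊗ f` with `f` a Lagrange polynomial acts
on one factor only. Burnside's theorem on each factor then gives all operators on the tensor
product. Root vectors act nilpotently on each finite-dimensional factor, and `p = ∏ (x - zᵢ)` gives
membership in `ℰ`. -/

noncomputable section

namespace AffineLie

/-! ### Burnside's theorem -/

section Burnside

variable {K U : Type*} [Field K] [IsAlgClosed K] [AddCommGroup U] [Module K U]
  [FiniteDimensional K U]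

/-- Burnside's theorem: an irreducible set of operators on a finite-dimensional space over an
algebraically closed field generates the algebra of all operators. -/
theorem adjoin_eq_top_of_irreducible [Nontrivial U] (S : Set (Module.End K U))
    (h : ∀ N : Submodule K U, (∀ f ∈ S, ∀ u ∈ N, f u ∈ N) → N = ⊥ ∨ N = ⊤) :
    Algebra.adjoin K S = ⊤ := by
  classical
  set A := Algebra.adjoin K S with hA
  have hsimple : IsSimpleModule A U := by
    refine { eq_bot_or_eq_top := fun N => ?_ }
    rcases h (N.restrictScalars K) fun f hf u hu =>
      N.smul_mem (⟨f, Algebra.subset_adjoin hf⟩ : A) hu with h | h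
    · exact Or.inl (by simpa using h)
    · exact Or.inr (by simpa using h)
  have hfin : Module.Finite A U := Module.Finite.of_restrictScalars_finite K A U
  refine eq_top_iff.2 fun f _ => ?_
  have hscalar := IsSimpleModule.algebraMap_end_bijective_of_isAlgClosed (A := A) (V := U) K
  -- By Schur's lemma the `A`-endomorphisms of `U` are scalars, so every linear `f` lies in the
  -- bicommutant. Density then matches `f` with an element of `A` on a whole basis.
  let g : Module.End (Module.End A U) U :=
    { toFun := f
      map_add' := map_add f
      map_smul' := fun φ u => by
        obtain ⟨c, rfl⟩ := hscalar.2 φ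
        simp }
  obtain ⟨a, ha⟩ := jacobson_density (R := A) g
    (Finset.univ.image (Module.finBasis K U))
  have : (a : Module.End K U) = f := (Module.finBasis K U).ext fun i =>
    (ha _ (Finset.mem_image_of_mem _ (Finset.mem_univ i))).symm
  exact this ▸ a.2

end Burnside

/-! ### Irreducibility of tensor products under factorwise operators -/

section TensorIrreducible

variable {K ι : Type*} [Field K] [DecidableEq ι] (M : ι → Type*)
  [∀ i, AddCommGroup (M i)] [∀ i, Module K (M i)]

theorem factorEnd_one (i : ι) : factorEnd (R := K) M i 1 = 1 := by
  refine PiTensorProduct.ext (MultilinearMap.ext fun u => ?_)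
  simp [factorEnd_tprod]

theorem factorEnd_smul (i : ι) (c : K) (f : Module.End K (M i)) :
    factorEnd M i (c • f) = c • factorEnd M i f :=
  PiTensorProduct.map_update_smul _ i c f

theorem factorEnd_zero (i : ι) : factorEnd (R := K) M i 0 = 0 := by
  simpa using factorEnd_smul M i (0 : K) 0

theorem factorEnd_mul (i : ι) (f g : Module.End K (M i)) :
    factorEnd M i (f * g) = factorEnd M i f * factorEnd M i g :=
  LinearMap.ext fun m => (factorEnd_mul_same M i f g m).symm

theorem factorEnd_pow (i : ι) (f : Module.End K (M i)) (n : ℕ) :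
    factorEnd M i (f ^ n) = factorEnd M i f ^ n := by
  induction n with
  | zero => simp [factorEnd_one]
  | succ n ih => rw [pow_succ, pow_succ, factorEnd_mul, ih]

variable {M}

theorem factorEnd_mem_of_adjoin_eq_top {N : Submodule K (⨂[K] j, M j)} {i : ι}
    {S : Set (Module.End K (M i))} (hS : Algebra.adjoin K S = ⊤)
    (h : ∀ f ∈ S, ∀ m ∈ N, factorEnd M i f m ∈ N) (f : Module.End K (M i)) :
    ∀ m ∈ N, factorEnd M i f m ∈ N := by
  have hf : f ∈ Algebra.adjoin K S := hS ▸ Algebra.mem_top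
  induction hf using Algebra.adjoin_induction with
  | mem f hf => exact h f hf
  | algebraMap c =>
    intro m hm
    rw [Algebra.algebraMap_eq_smul_one, factorEnd_smul, factorEnd_one]
    exact N.smul_mem c hm
  | add f g _ _ hf hg =>
    intro m hm
    rw [factorEnd_add]
    exact N.add_mem (hf m hm) (hg m hm)
  | mul f g _ _ hf hg =>
    intro m hm
    rw [factorEnd_mul]
    exact hf _ (hg m hm)

/-- A tensor product of operators is the composite of its actions on single factors, which are
inserted one index at a time. -/
theorem map_mem_of_factorEnd_mem [Fintype ι] {N : Submodule K (⨂[K] j, M j)}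
    (h : ∀ i (f : Module.End K (M i)), ∀ m ∈ N, factorEnd M i f m ∈ N)
    (f : ∀ i, Module.End K (M i)) : ∀ m ∈ N, PiTensorProduct.map f m ∈ N := by
  have key : ∀ s : Finset ι, ∀ m ∈ N,
      PiTensorProduct.map (fun i => if i ∈ s then f i else LinearMap.id) m ∈ N := by
    intro s
    induction s using Finset.induction_on with
    | empty => intro m hm; simpa [PiTensorProduct.map_id] using hm
    | insert i s hi ih =>
      intro m hm
      have e : PiTensorProduct.map (fun j => if j ∈ insert i s then f j else LinearMap.id) =
          factorEnd M i (f i) ∘ₗ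
            PiTensorProduct.map (fun j => if j ∈ s then f j else LinearMap.id) := by
        rw [factorEnd, ← PiTensorProduct.map_comp]
        congr 1
        funext j
        by_cases hj : j = i
        · subst hj; simp [hi]
        · simp [hj]
      rw [e]
      exact h i _ _ (ih m hm)
  simpa using key Finset.univ

/-- The tensor product of finite-dimensional spaces is irreducible under the operators that act on
single factors through generating sets of the full operator algebras. -/
theorem eq_bot_or_eq_top_of_factorEnd_mem [Fintype ι] [∀ i, FiniteDimensional K (M i)]
    {N : Submodule K (⨂[K] j, M j)} (S : ∀ i, Set (Module.End K (M i)))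
    (hS : ∀ i, Algebra.adjoin K (S i) = ⊤)
    (h : ∀ i, ∀ f ∈ S i, ∀ m ∈ N, factorEnd M i f m ∈ N) : N = ⊥ ∨ N = ⊤ := by
  have hmap := map_mem_of_factorEnd_mem fun i f =>
    factorEnd_mem_of_adjoin_eq_top (hS i) (h i) f
  by_cases hN : N = ⊥
  · exact Or.inl hN
  obtain ⟨m, hm, hm0⟩ := (Submodule.ne_bot_iff N).1 hN
  let b := fun i => Module.finBasis K (M i)
  let B := Basis.piTensorProduct b
  obtain ⟨p, hp⟩ : ∃ p, B.repr m p ≠ 0 := by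
    by_contra! h0
    exact hm0 (B.repr.map_eq_zero_iff.1 (Finsupp.ext h0))
  -- Tensor products of matrix units are matrix units. This one sends `m` to its nonzero `p`-th
  -- coordinate times `B q`, so every basis vector lies in `N`.
  have hE : ∀ q, PiTensorProduct.map
      (fun i => ((b i).coord (p i)).smulRight (b i (q i))) =
        (B.coord p).smulRight (B q) := by
    intro q
    refine PiTensorProduct.ext (MultilinearMap.ext fun u => ?_)
    simp [B, MultilinearMap.map_smul_univ]
  refine Or.inr (eq_top_iff.2 ?_)
  rw [← B.span_eq, Submodule.span_le]
  rintro _ ⟨q, rfl⟩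
  have := hmap (fun i => ((b i).coord (p i)).smulRight (b i (q i))) m hm
  rw [hE q] at this
  simpa [hp] using N.smul_mem (B.repr m p)⁻¹ this

end TensorIrreducible

/-! ### Two-sided linear recurrences -/

section Recurrence

variable {K E : Type*} [Field K] [AddCommGroup E] [Module K E]

/-- Solves the recurrence for the term with the nonzero coefficient `p.coeff k₀`. It is applied with
`k₀` the degree to move up and with `k₀` the trailing degree to move down. -/
theorem mem_of_recurrence {p : Polynomial K} {s : ℤ → E} {V : Submodule K E} {j : ℤ}
    (h : (p.sum fun k c => c • s (j + k)) = 0) {k₀ : ℕ} (hk₀ : p.coeff k₀ ≠ 0)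
    (hV : ∀ k ∈ p.support, k ≠ k₀ → s (j + k) ∈ V) : s (j + k₀) ∈ V := by
  rw [Polynomial.sum_def, ← Finset.add_sum_erase _ _ (Polynomial.mem_support_iff.2 hk₀)] at h
  have h1 : p.coeff k₀ • s (j + k₀) ∈ V := by
    rw [eq_neg_of_add_eq_zero_left h]
    refine V.neg_mem (V.sum_mem fun k hk => V.smul_mem _ ?_)
    exact hV k (Finset.mem_of_mem_erase hk) (Finset.ne_of_mem_erase hk)
  simpa [hk₀] using V.smul_mem (p.coeff k₀)⁻¹ h1

/-- A two-sided sequence that satisfies a linear recurrence spans a finite-dimensional space. -/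
theorem finiteDimensional_span_of_recurrence {p : Polynomial K} (hp : p ≠ 0) {s : ℤ → E}
    (h : ∀ j : ℤ, (p.sum fun k c => c • s (j + k)) = 0) :
    FiniteDimensional K (Submodule.span K (Set.range s)) := by
  -- As many consecutive terms as the degree of `p` determine the sequence in both directions.
  let V := Submodule.span K (s '' Set.Ico 0 (p.natDegree : ℤ))
  have hVfin : FiniteDimensional K V :=
    FiniteDimensional.span_of_finite K ((Set.finite_Ico _ _).image s)
  have hup : ∀ n : ℕ, s n ∈ V := by
    intro n
    induction n using Nat.strong_induction_on with
    | _ n ih =>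
      by_cases hn : n < p.natDegree
      · exact Submodule.subset_span ⟨n, ⟨by omega, by exact_mod_cast hn⟩, rfl⟩
      · push Not at hn
        have e : (n : ℤ) = ((n : ℤ) - p.natDegree) + (p.natDegree : ℕ) := by ring
        rw [e]
        refine mem_of_recurrence (h _) (by simpa using hp) fun k hk hne => ?_
        have hk' := Polynomial.le_natDegree_of_mem_supp k hk
        have e' : (n : ℤ) - p.natDegree + k = ((n - p.natDegree + k : ℕ) : ℤ) := by
          push_cast [hn]; ring
        rw [e']
        exact ih _ (by omega)
  have hdown : ∀ n : ℕ, s (-n) ∈ V := by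
    intro n
    induction n using Nat.strong_induction_on with
    | _ n ih =>
      have e : -(n : ℤ) = (-(n : ℤ) - p.natTrailingDegree) + (p.natTrailingDegree : ℕ) := by ring
      rw [e]
      refine mem_of_recurrence (h _) (by simpa using hp) fun k hk hne => ?_
      have hk' := Polynomial.natTrailingDegree_le_of_mem_supp k hk
      rcases le_total n (k - p.natTrailingDegree) with hle | hle
      · have e' : -(n : ℤ) - p.natTrailingDegree + k =
            ((k - p.natTrailingDegree - n : ℕ) : ℤ) := by omega
        rw [e']
        exact hup _
      · have e' : -(n : ℤ) - p.natTrailingDegree + k =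
            -((n - (k - p.natTrailingDegree) : ℕ) : ℤ) := by omega
        rw [e']
        exact ih _ (by omega)
  refine Submodule.finiteDimensional_of_le (S₂ := V) (Submodule.span_le.2 ?_)
  rintro _ ⟨n, rfl⟩
  obtain ⟨m, rfl | rfl⟩ := n.eq_nat_or_neg
  · exact hup m
  · exact hdown m

end Recurrence

/-! ### Exponentials of locally nilpotent operators -/

section LocallyNilpotent

variable {K W : Type*} [Field K] [AddCommGroup W] [Module K W]

/-- An operator is locally nilpotent if every vector is killed by some power of it. -/
def IsLocallyNilpotent (f : Module.End K W) : Prop :=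
  ∀ w, ∃ k : ℕ, (f ^ k) w = 0

/-- Partial sums of the exponential series of an operator. -/
def expSum (f : Module.End K W) (n : ℕ) : Module.End K W :=
  ∑ k ∈ Finset.range n, ((k.factorial : K)⁻¹) • f ^ k

theorem expSum_succ (f : Module.End K W) (n : ℕ) :
    expSum f (n + 1) = expSum f n + ((n.factorial : K)⁻¹) • f ^ n :=
  Finset.sum_range_succ _ _

theorem expSum_eq_of_le {f : Module.End K W} {w : W} {n m : ℕ} (h : (f ^ n) w = 0) (hnm : n ≤ m) :
    expSum f m w = expSum f n w := by
  induction m, hnm using Nat.le_induction with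
  | base => rfl
  | succ m hm ih =>
    rw [expSum_succ, LinearMap.add_apply, ih, LinearMap.smul_apply,
      Module.End.pow_map_zero_of_le hm h, smul_zero, add_zero]

variable {e f h h' : Module.End K W}

/-- Leibniz expansion `eᴺ f = ∑ C(N,i) (ad e)ⁱ(f) eᴺ⁻ⁱ` with `N = k + 2`, which stops at `i = 2`
because `(ad e)³ f = 0`. -/
theorem pow_mul_of_commutators (heh : e * f = f * e + h) (heh' : e * h = h * e + h')
    (hc : e * h' = h' * e) [CharZero K] (k : ℕ) :
    e ^ (k + 2) * f = f * e ^ (k + 2) + ((k : K) + 2) • (h * e ^ (k + 1)) +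
      (((k : K) + 2) * (k + 1) / 2) • (h' * e ^ k) := by
  induction k with
  | zero =>
    have h1 : e ^ (0 + 2) * f = e * (e * f) := by rw [zero_add, pow_two, mul_assoc]
    rw [h1, heh, mul_add, ← mul_assoc, heh, add_mul, heh', mul_assoc, ← pow_two]
    simp only [zero_add, pow_zero, pow_one, mul_one, Nat.cast_zero]
    module
  | succ k ih =>
    rw [pow_succ' e (k + 1 + 1), mul_assoc, ih, mul_add, mul_add, mul_smul_comm, mul_smul_comm,
      ← mul_assoc, heh, ← mul_assoc, heh', ← mul_assoc, hc, add_mul, add_mul,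
      mul_assoc f, ← pow_succ', mul_assoc h, ← pow_succ', mul_assoc h', ← pow_succ']
    push_cast
    module

/-- The truncated form of `exp(e) f = (exp(ad e) f) exp(e)`. Each application of `ad e` uses up one
power of `e`, which is why the partial sums on the right shorten by one and by two. -/
theorem expSum_mul_of_commutators [CharZero K] (heh : e * f = f * e + h)
    (heh' : e * h = h * e + h') (hc : e * h' = h' * e) (m : ℕ) :
    expSum e (m + 2) * f =
      f * expSum e (m + 2) + h * expSum e (m + 1) + (1 / 2 : K) • (h' * expSum e m) := by
  induction m with
  | zero =>
    simp only [expSum, Finset.sum_range_succ, Finset.range_zero, Finset.sum_empty, zero_add,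
      Nat.factorial, pow_zero, pow_one, mul_add, add_mul, mul_one]
    simp [heh]
    abel
  | succ k ih =>
    have a₁ : expSum e (k + 1 + 2) = expSum e (k + 2) + _ := expSum_succ e (k + 2)
    have a₂ : expSum e (k + 1 + 1) = expSum e (k + 1) + _ := expSum_succ e (k + 1)
    rw [a₁, add_mul, ih, smul_mul_assoc, pow_mul_of_commutators heh heh' hc, a₂, expSum_succ e k]
    have h1 : ((k + 2).factorial : K)⁻¹ * (k + 2) = ((k + 1).factorial : K)⁻¹ := by
      have : (k : K) + 2 ≠ 0 := by exact_mod_cast (by omega : k + 2 ≠ 0)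
      have h2 : ((k + 1).factorial : K) ≠ 0 := by exact_mod_cast (k + 1).factorial_ne_zero
      rw [Nat.factorial_succ (k + 1)]
      push_cast
      rw [show (k : K) + 1 + 1 = k + 2 by ring]
      field_simp
    have h2 : ((k + 2).factorial : K)⁻¹ * ((k + 2) * (k + 1) / 2) = 1 / 2 * (k.factorial : K)⁻¹ := by
      rw [mul_div_assoc, ← mul_assoc, h1]
      have : (k : K) + 1 ≠ 0 := by exact_mod_cast (by omega : k + 1 ≠ 0)
      have h2 : (k.factorial : K) ≠ 0 := by exact_mod_cast k.factorial_ne_zero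
      rw [Nat.factorial_succ k]
      push_cast
      field_simp
    simp only [smul_add, smul_smul, h1, h2]
    simp only [mul_add, mul_smul_comm, smul_add, smul_smul]
    abel

/-- Surjectivity of `exp(e)`, by induction on the order of nilpotency at `v`: as `exp(e) - 1` is
divisible by `e`, the vector `(exp(e) - 1) v` is killed by a smaller power. If it equals `exp(e) w`,
then `exp(e)(v - w) = v`. -/
theorem exists_expSum_eq (he : IsLocallyNilpotent e) (v : W) :
    ∃ w, ∃ n, ∀ m, n ≤ m → expSum e m w = v := by
  obtain ⟨k, hk⟩ := he v
  induction k generalizing v with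
  | zero => exact ⟨0, 0, fun m _ => by rw [map_zero]; simpa using hk.symm⟩
  | succ k ih =>
    have hc : Commute (e ^ k) (expSum e (k + 1) - 1) :=
      (Commute.sum_right _ _ _ fun i _ => ((Commute.refl e).pow_pow k i).smul_right _).sub_right
        (Commute.one_right _)
    have hmul : e ^ k * (expSum e (k + 1) - 1) =
        (∑ i ∈ Finset.range k, (((i + 1).factorial : K)⁻¹) • e ^ i) * e ^ (k + 1) := by
      rw [expSum, Finset.sum_range_succ']
      simp only [Nat.factorial_zero, Nat.cast_one, inv_one, pow_zero, one_smul,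
        add_sub_cancel_right, Finset.mul_sum, Finset.sum_mul, mul_smul_comm, smul_mul_assoc,
        ← pow_add]
      refine Finset.sum_congr rfl fun i _ => ?_
      congr 2
      omega
    obtain ⟨w, n, hw⟩ := ih ((expSum e (k + 1) - 1) v) (by
      rw [← Module.End.mul_apply, hmul, Module.End.mul_apply, hk, map_zero])
    refine ⟨v - w, max n (k + 1), fun m hm => ?_⟩
    rw [map_sub, hw m (le_trans (le_max_left _ _) hm),
      expSum_eq_of_le hk (le_trans (le_max_right _ _) hm)]
    simp

/-- If `e` and `f` are locally nilpotent and `(ad e)³ f = 0` then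
`exp(ad e) f = f + [e, f] + [e, [e, f]] / 2` is locally nilpotent. -/
theorem isLocallyNilpotent_exp_conj [CharZero K] (he : IsLocallyNilpotent e)
    (hf : IsLocallyNilpotent f) (heh : e * f = f * e + h) (heh' : e * h = h * e + h')
    (hc : e * h' = h' * e) : IsLocallyNilpotent (f + h + (1 / 2 : K) • h') := by
  intro v
  obtain ⟨w, n, hw⟩ := exists_expSum_eq he v
  -- With `v = exp(e) w`, this is `exp(e) fᵏ w = (exp(ad e) f)ᵏ v`; a power of `f` killing `w` then
  -- gives a power of the conjugate killing `v`.
  have key : ∀ k, ∃ n, ∀ m, n ≤ m →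
      expSum e m ((f ^ k) w) = ((f + h + (1 / 2 : K) • h') ^ k) v := by
    intro k
    induction k with
    | zero => exact ⟨n, by simpa using hw⟩
    | succ k ih =>
      obtain ⟨n, hn⟩ := ih
      refine ⟨n + 2, fun m hm => ?_⟩
      obtain ⟨m, rfl⟩ : ∃ i, m = i + 2 := ⟨m - 2, by omega⟩
      rw [pow_succ' f, pow_succ' (f + h + _), Module.End.mul_apply, Module.End.mul_apply,
        ← Module.End.mul_apply (expSum e (m + 2)), expSum_mul_of_commutators heh heh' hc]
      simp only [LinearMap.add_apply, Module.End.mul_apply, LinearMap.smul_apply]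
      rw [hn m (by omega), hn (m + 1) (by omega), hn (m + 2) (by omega)]
  obtain ⟨k, hk⟩ := hf w
  obtain ⟨n, hn⟩ := key k
  exact ⟨k, by rw [← hn n le_rfl, hk, map_zero]⟩

end LocallyNilpotent

/-! ### Straightening words in finitely many operators -/

section Words

variable {K W ι : Type*} [Field K] [AddCommGroup W] [Module K W] (x : ι → Module.End K W) (w : W)

/-- The span of the vectors `x_{i₁} ⋯ x_{i_k} w` with `k ≤ n`. -/
def wordSpan (n : ℕ) : Submodule K W :=
  Submodule.span K ((fun l : List ι => (l.map x).prod w) '' {l | l.length ≤ n})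

variable {x w}

theorem word_mem_wordSpan {n : ℕ} {l : List ι} (hl : l.length ≤ n) :
    (l.map x).prod w ∈ wordSpan x w n :=
  Submodule.subset_span ⟨l, hl, rfl⟩

theorem wordSpan_mono {m n : ℕ} (h : m ≤ n) : wordSpan x w m ≤ wordSpan x w n :=
  Submodule.span_mono (Set.image_mono fun _ hl => le_trans hl h)

theorem apply_mem_wordSpan {n : ℕ} (i : ι) {v : W} (hv : v ∈ wordSpan x w n) :
    x i v ∈ wordSpan x w (n + 1) := by
  induction hv using Submodule.span_induction with
  | mem v hv =>
    obtain ⟨l, hl, rfl⟩ := hv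
    exact word_mem_wordSpan (l := i :: l) (by simpa using hl)
  | zero => simp
  | add u v _ _ hu hv => rw [map_add]; exact add_mem hu hv
  | smul c v _ hv => rw [map_smul]; exact Submodule.smul_mem _ c hv

/-- Swapping adjacent letters costs a commutator, which is a combination of single letters and so
produces only shorter words. -/
theorem word_sub_word_mem_wordSpan
    (hx : ∀ i j, x i * x j - x j * x i ∈ Submodule.span K (Set.range x)) {l l' : List ι}
    (h : l.Perm l') :
    (l.map x).prod w - (l'.map x).prod w ∈ wordSpan x w (l.length - 1) := by
  induction h with
  | nil => simp
  | @cons i l₁ l₂ h ih =>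
    rcases l₁ with _ | ⟨j, l₁⟩
    · obtain rfl := h.nil_eq
      simp
    · have := apply_mem_wordSpan i ih
      simpa using this
  | swap i j l =>
    have h1 : ∀ y ∈ Submodule.span K (Set.range x),
        y ((l.map x).prod w) ∈ wordSpan x w (l.length + 1) := by
      intro y hy
      induction hy using Submodule.span_induction with
      | mem y hy =>
        obtain ⟨k, rfl⟩ := hy
        exact apply_mem_wordSpan k (word_mem_wordSpan le_rfl)
      | zero => simp
      | add u v _ _ hu hv => exact add_mem hu hv
      | smul c v _ hv => exact Submodule.smul_mem _ c hv
    simpa [mul_assoc] using h1 _ (hx j i)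
  | @trans l₁ l₂ l₃ h₁ h₂ ih₁ ih₂ =>
    rw [← h₁.length_eq] at ih₂
    simpa using add_mem ih₁ ih₂

/-- In a word longer than `card ι * k` some letter occurs at least `k` times. Moving `k` copies to
the right end, next to `w`, kills the word up to shorter ones. -/
theorem wordSpan_succ_le [Fintype ι]
    (hx : ∀ i j, x i * x j - x j * x i ∈ Submodule.span K (Set.range x)) {k : ℕ}
    (hk : ∀ i, (x i ^ k) w = 0) {n : ℕ} (hn : Fintype.card ι * k ≤ n) :
    wordSpan x w (n + 1) ≤ wordSpan x w n := by
  classical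
  refine Submodule.span_le.2 ?_
  rintro _ ⟨l, hl, rfl⟩
  rcases Nat.lt_or_ge n l.length with hlt | hle
  · obtain ⟨i, hi⟩ : ∃ i, k ≤ l.count i := by
      by_contra! hcon
      have h1 : l.length = ∑ i, l.count i := by
        simpa using (Multiset.sum_count_eq_card (s := Finset.univ) (m := (l : Multiset ι))
          fun _ _ => Finset.mem_univ _).symm
      have h2 : ∑ i, l.count i ≤ ∑ _i : ι, k := Finset.sum_le_sum fun i _ => (hcon i).le
      rw [Finset.sum_const, Finset.card_univ, smul_eq_mul] at h2
      omega
    obtain ⟨l', hl'⟩ := (List.replicate_sublist_iff.2 hi).exists_perm_append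
    have h1 := word_sub_word_mem_wordSpan (w := w) hx (hl'.trans List.perm_append_comm)
    rw [List.map_append, List.prod_append, List.map_replicate, List.prod_replicate,
      Module.End.mul_apply, hk, map_zero, sub_zero] at h1
    exact wordSpan_mono (by have : l.length ≤ n + 1 := hl; omega) h1
  · exact word_mem_wordSpan hle

/-- If finitely many operators span a Lie algebra and are nilpotent on a vector `w`, then `w` lies in
a finite-dimensional subspace stable under these operators. -/
theorem exists_finiteDimensional_stable [Finite ι]
    (hx : ∀ i j, x i * x j - x j * x i ∈ Submodule.span K (Set.range x))
    (hw : ∀ i, ∃ k : ℕ, (x i ^ k) w = 0) :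
    ∃ V : Submodule K W, FiniteDimensional K V ∧ w ∈ V ∧ ∀ i, ∀ v ∈ V, x i v ∈ V := by
  have := Fintype.ofFinite ι
  choose k hk using hw
  have hk' : ∀ i, (x i ^ (∑ j, k j)) w = 0 := fun i =>
    Module.End.pow_map_zero_of_le (Finset.single_le_sum (fun _ _ => Nat.zero_le _)
      (Finset.mem_univ i)) (hk i)
  refine ⟨wordSpan x w (Fintype.card ι * ∑ j, k j), ?_, ?_, ?_⟩
  · exact FiniteDimensional.span_of_finite K ((List.finite_length_le ι _).image _)
  · exact word_mem_wordSpan (l := []) (Nat.zero_le _)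
  · exact fun i v hv => wordSpan_succ_le hx hk' le_rfl (apply_mem_wordSpan i hv)

end Words

attribute [local instance] LieRing.ofAssociativeRing

/-! ### The loop algebra action and the vanishing of the central element -/

section LoopAction

variable {𝔤 : Type*} [LieRing 𝔤] [LieAlgebra ℂ 𝔤]
  (Φ : LinearMap.BilinForm ℂ 𝔤) (hΦ : Φ.lieInvariant 𝔤) (hΦs : Φ.IsSymm)

/-- The inclusion of the loop algebra into the affine Lie algebra, as a linear map. -/
def loopIncl : LieAlgebra.loopAlgebra ℂ ℤ 𝔤 →ₗ[ℂ] Affine Φ hΦ hΦs where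
  toFun y := ⟨(y, 0)⟩
  map_add' _ _ := congrArg LieAlgebra.ofTwoCocycle.mk (Prod.ext rfl (add_zero _).symm)
  map_smul' _ _ := congrArg LieAlgebra.ofTwoCocycle.mk (Prod.ext rfl (smul_zero _).symm)

/-- The bilinear map `(f, a) ↦ a ⊗ f` from Laurent polynomials and a Lie algebra to the affine Lie
algebra. -/
def loopLin : LaurentPolynomial ℂ →ₗ[ℂ] 𝔤 →ₗ[ℂ] Affine Φ hΦ hΦs :=
  (TensorProduct.mk ℂ (AddMonoidAlgebra ℂ ℤ) 𝔤).compr₂ (loopIncl Φ hΦ hΦs)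

theorem T_smul_induction {P : LaurentPolynomial ℂ → Prop}
    (hT : ∀ n : ℤ, P (LaurentPolynomial.T n)) (hadd : ∀ f g, P f → P g → P (f + g))
    (hsmul : ∀ (c : ℂ) f, P f → P (c • f)) (f : LaurentPolynomial ℂ) : P f := by
  induction f using AddMonoidAlgebra.induction_linear with
  | zero => simpa using hsmul 0 _ (hT 0)
  | add f g hf hg => exact hadd f g hf hg
  | single n c =>
    have : (AddMonoidAlgebra.single n c : LaurentPolynomial ℂ) =
        c • (LaurentPolynomial.T n : LaurentPolynomial ℂ) := by
      rw [LaurentPolynomial.T, AddMonoidAlgebra.smul_single, smul_eq_mul, mul_one]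
    exact this ▸ hsmul c _ (hT n)

/-- The elements `a(n)` and the central element span the affine Lie algebra. -/
theorem span_loopElt_central : Submodule.span ℂ
    (insert (central Φ hΦ hΦs) {x | ∃ a n, loopElt Φ hΦ hΦs a n = x}) = ⊤ := by
  set S := Submodule.span ℂ (insert (central Φ hΦ hΦs) {x | ∃ a n, loopElt Φ hΦ hΦs a n = x})
  have h1 : ∀ f a, loopLin Φ hΦ hΦs f a ∈ S := by
    intro f a
    induction f using T_smul_induction with
    | hT n => exact Submodule.subset_span (Or.inr ⟨a, n, rfl⟩)
    | hadd f g hf hg => rw [map_add]; exact add_mem hf hg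
    | hsmul c f hf => rw [map_smul]; exact S.smul_mem c hf
  have h2 : ∀ y, loopIncl Φ hΦ hΦs y ∈ S := by
    intro y
    induction y using TensorProduct.induction_on with
    | zero => rw [map_zero]; exact S.zero_mem
    | tmul f a => exact h1 f a
    | add y z hy hz => rw [map_add]; exact add_mem hy hz
  refine eq_top_iff.2 fun x _ => ?_
  obtain ⟨⟨y, c⟩⟩ := x
  have h3 : (⟨(y, c)⟩ : Affine Φ hΦ hΦs) = loopIncl Φ hΦ hΦs y +
      (TrivialLieModule.equiv ℂ (LieAlgebra.loopAlgebra ℂ ℤ 𝔤) ℂ c) • central Φ hΦ hΦs := by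
    refine congrArg LieAlgebra.ofTwoCocycle.mk (Prod.ext ?_ ?_)
    · change y = y + (_ : ℂ) • 0
      rw [smul_zero, add_zero]
    · change c = 0 + (_ : ℂ) • (TrivialLieModule.equiv ℂ (LieAlgebra.loopAlgebra ℂ ℤ 𝔤) ℂ).symm 1
      rw [zero_add, ← map_smul, smul_eq_mul, mul_one, LinearEquiv.symm_apply_apply]
  rw [h3]
  exact add_mem (h2 y) (S.smul_mem _ (Submodule.subset_span (Or.inl rfl)))

variable (W : Type*) [AddCommGroup W] [Module ℂ W] [LieRingModule (Affine Φ hΦ hΦs) W]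
  [LieModule ℂ (Affine Φ hΦ hΦs) W]

/-- The operators `a ⊗ f` on a module over the affine Lie algebra. -/
def loopAct : LaurentPolynomial ℂ →ₗ[ℂ] 𝔤 →ₗ[ℂ] Module.End ℂ W :=
  (loopLin Φ hΦ hΦs).compr₂ (LieModule.toEnd ℂ (Affine Φ hΦ hΦs) W).toLinearMap

theorem loopAct_T (n : ℤ) (a : 𝔤) :
    loopAct Φ hΦ hΦs W (LaurentPolynomial.T n) a =
      LieModule.toEnd ℂ (Affine Φ hΦ hΦs) W (loopElt Φ hΦ hΦs a n) := rfl

variable {W}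

/-- When `k` acts as zero the cocycle term disappears and the loop algebra itself acts. -/
theorem loopAct_lie_loopAct (hc : LieModule.toEnd ℂ (Affine Φ hΦ hΦs) W (central Φ hΦ hΦs) = 0)
    (f g : LaurentPolynomial ℂ) (a b : 𝔤) :
    ⁅loopAct Φ hΦ hΦs W f a, loopAct Φ hΦ hΦs W g b⁆ = loopAct Φ hΦ hΦs W (f * g) ⁅a, b⁆ := by
  induction f using T_smul_induction with
  | hT m =>
    induction g using T_smul_induction with
    | hT n =>
      rw [loopAct_T, loopAct_T, ← LieHom.map_lie, loopElt_lie_loopElt, map_add, map_smul, hc,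
        smul_zero, add_zero, ← LaurentPolynomial.T_add, loopAct_T]
    | hadd f g hf hg =>
      rw [map_add, LinearMap.add_apply, lie_add, hf, hg, mul_add, map_add, LinearMap.add_apply]
    | hsmul c f hf =>
      rw [map_smul, LinearMap.smul_apply, lie_smul, hf, mul_smul_comm, map_smul,
        LinearMap.smul_apply]
  | hadd f g hf hg =>
    rw [map_add, LinearMap.add_apply, add_lie, hf, hg, add_mul, map_add, LinearMap.add_apply]
  | hsmul c f hf =>
    rw [map_smul, LinearMap.smul_apply, smul_lie, hf, smul_mul_assoc, map_smul,
      LinearMap.smul_apply]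

theorem toEnd_loopElt_commutator (W : Type*) [AddCommGroup W] [Module ℂ W]
    [LieRingModule (Affine Φ hΦ hΦs) W] [LieModule ℂ (Affine Φ hΦ hΦs) W] (a b : 𝔤) (m n : ℤ) :
    LieModule.toEnd ℂ (Affine Φ hΦ hΦs) W (loopElt Φ hΦ hΦs a m) *
        LieModule.toEnd ℂ (Affine Φ hΦ hΦs) W (loopElt Φ hΦ hΦs b n) -
      LieModule.toEnd ℂ (Affine Φ hΦ hΦs) W (loopElt Φ hΦ hΦs b n) *
        LieModule.toEnd ℂ (Affine Φ hΦ hΦs) W (loopElt Φ hΦ hΦs a m) =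
    LieModule.toEnd ℂ (Affine Φ hΦ hΦs) W (loopElt Φ hΦ hΦs ⁅a, b⁆ (m + n)) +
      ((m : ℂ) * Φ a b * (if m + n = 0 then 1 else 0)) •
        LieModule.toEnd ℂ (Affine Φ hΦ hΦs) W (central Φ hΦ hΦs) := by
  rw [← LieRing.of_associative_ring_bracket, ← LieHom.map_lie, loopElt_lie_loopElt, map_add,
    map_smul]

/-- Commuting the first relation with `b` and subtracting the second leaves only the multiples of
`z`, which will be the central element. -/
theorem sum_smul_eq_zero_of_commutators {A : Type*} [Ring A] [Algebra ℂ A] {p : Polynomial ℂ}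
    {x y : ℕ → A} {b z : A} {c : ℕ → ℂ} (hx : (p.sum fun k d => d • x k) = 0)
    (hy : (p.sum fun k d => d • y k) = 0) (h : ∀ k, x k * b - b * x k = y k + c k • z) :
    (p.sum fun k d => (d * c k) • z) = 0 := by
  have e : ∀ k d, (d * c k) • z = (d • x k) * b - b * (d • x k) - d • y k := by
    intro k d
    rw [smul_mul_assoc, mul_smul_comm, ← smul_sub, h, smul_add, add_sub_cancel_left, smul_smul]
  simp only [Polynomial.sum_def] at hx hy ⊢
  simp only [e, Finset.sum_sub_distrib, ← Finset.sum_mul, ← Finset.mul_sum, hx, hy]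
  simp

/-- If `p(t) ≠ 0` and all elements `a ⊗ tʲ p(t)` act as zero then the central element acts as zero,
provided that the form is nonzero. -/
theorem toEnd_central_eq_zero (h0 : Φ ≠ 0) {p : Polynomial ℂ} (hp : p ≠ 0)
    (h : ∀ (a : 𝔤) (j : ℤ), (p.sum fun k c => c •
      LieModule.toEnd ℂ (Affine Φ hΦ hΦs) W (loopElt Φ hΦ hΦs a (j + k))) = 0) :
    LieModule.toEnd ℂ (Affine Φ hΦ hΦs) W (central Φ hΦ hΦs) = 0 := by
  obtain ⟨a, b, hab⟩ : ∃ a b, Φ a b ≠ 0 := by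
    by_contra! hcon
    exact h0 (LinearMap.ext₂ hcon)
  let d := p.natDegree
  have hd : p.coeff d ≠ 0 := by simpa [d] using hp
  let ρ := LieModule.toEnd ℂ (Affine Φ hΦ hΦs) W
  have key : ∀ m n : ℤ, (p.sum fun k c => (c * ((m + k : ℤ) * Φ a b *
      (if m + k + n = 0 then 1 else 0))) • ρ (central Φ hΦ hΦs)) = 0 := by
    intro m n
    have h1 := h a m
    have h2 := h ⁅a, b⁆ (m + n)
    have hcomm := fun k : ℕ => toEnd_loopElt_commutator Φ hΦ hΦs W a b (m + k) n
    simp only [add_right_comm m _ n] at hcomm ⊢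
    exact sum_smul_eq_zero_of_commutators h1 h2 hcomm
  -- With `m = 1 - d` and `n = -1` the delta is nonzero only at `k = d`, where the factor `m + k` is
  -- `1`; what remains is `p_d Φ(a, b)` times the central element.
  have h1 := key (1 - d) (-1)
  rw [Polynomial.sum_def, Finset.sum_eq_single d] at h1
  · simpa [hd, hab] using h1
  · intro k _ hk
    rw [if_neg (by omega)]
    simp
  · intro hd'
    simp [Polynomial.notMem_support_iff.1 hd']

end LoopAction

/-! ### The normalized form is nonzero -/

section NormalizedForm

variable {𝔤 : Type*} [LieRing 𝔤] [LieAlgebra ℂ 𝔤] [FiniteDimensional ℂ 𝔤]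
  [LieAlgebra.IsSimple ℂ 𝔤]

theorem nonempty_root (H : LieSubalgebra ℂ 𝔤) [H.IsCartanSubalgebra] : Nonempty H.root := by
  by_contra hcon
  rw [not_nonempty_iff] at hcon
  have h1 := LieAlgebra.IsKilling.span_weight_isNonZero_eq_top ℂ 𝔤 H
  have h2 : {α : LieModule.Weight ℂ H 𝔤 | α.IsNonZero} = ∅ := by
    refine Set.eq_empty_of_forall_notMem fun α hα => hcon.false ⟨α, ?_⟩
    simpa using hα
  have : Nontrivial 𝔤 := LieModule.nontrivial_of_isIrreducible ℂ 𝔤 𝔤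
  have h3 : Nontrivial H := inferInstance
  rw [h2, Set.image_empty, Submodule.span_empty] at h1
  exact bot_ne_top h1

/-- For the coroot `h` of `α`, the Killing form value `κ(h, h)` is both `4 / t`, with `t` the
squared length of `α`, and `∑ β(h)²` over the roots. The numbers `β(h)` are integers and `α(h) = 2`,
so the sum is positive. -/
theorem rootSqLength_re_pos (H : LieSubalgebra ℂ 𝔤) [H.IsCartanSubalgebra]
    {α : LieModule.Weight ℂ H 𝔤} (hα : α ∈ H.root) : 0 < (rootSqLength H α).re := by
  have hα' : α.IsNonZero := by simpa using hα
  set t := rootSqLength H α with ht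
  have ht0 : t ≠ 0 := LieAlgebra.IsKilling.root_apply_cartanEquivDual_symm_ne_zero hα'
  have h1 := LieAlgebra.IsKilling.traceForm_coroot α (LieAlgebra.IsKilling.coroot α)
  rw [LieAlgebra.IsKilling.root_apply_coroot hα'] at h1
  change _ = 2 • t⁻¹ • 2 at h1
  have h2 := congrArg (fun B => B (LieAlgebra.IsKilling.coroot α) (LieAlgebra.IsKilling.coroot α))
    (LieAlgebra.IsKilling.restrict_killingForm_eq_sum (H := H))
  rw [LieAlgebra.restrict_killingForm] at h2
  set h := LieAlgebra.IsKilling.coroot α with hh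
  have h3 : ∀ β : LieModule.Weight ℂ H 𝔤, ∃ n : ℤ, β h = n := fun β =>
    ⟨_, (LieAlgebra.IsKilling.apply_coroot_eq_cast α β).trans (by norm_cast)⟩
  choose n hn using h3
  have hn' : ∀ β, LieModule.Weight.toLinear ℂ H 𝔤 β h = n β := hn
  have h4 : ((4 : ℝ) : ℂ) * t⁻¹ = ((∑ β ∈ H.root, (n β : ℝ) ^ 2 : ℝ) : ℂ) := by
    calc ((4 : ℝ) : ℂ) * t⁻¹ = 2 • t⁻¹ • 2 := by simp; ring
      _ = _ := h1.symm
      _ = _ := h2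
      _ = _ := by simp [hn', pow_two]
  have h5 : 0 < ∑ β ∈ H.root, (n β : ℝ) ^ 2 := by
    refine Finset.sum_pos' (fun _ _ => sq_nonneg _) ⟨α, hα, ?_⟩
    have h6 : (n α : ℂ) = 2 := (hn α).symm.trans (LieAlgebra.IsKilling.root_apply_coroot hα')
    have h7 : n α = 2 := by exact_mod_cast h6
    rw [h7]
    norm_num
  have h8 : t = ((4 / ∑ β ∈ H.root, (n β : ℝ) ^ 2 : ℝ) : ℂ) := by
    rw [Complex.ofReal_div, ← h4]
    field_simp
  rw [h8, Complex.ofReal_re]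
  positivity

theorem longSqLength_pos (H : LieSubalgebra ℂ 𝔤) [H.IsCartanSubalgebra] : 0 < longSqLength H := by
  obtain ⟨α⟩ := nonempty_root H
  exact (rootSqLength_re_pos H α.2).trans_le
    (le_ciSup (f := fun α : H.root => (rootSqLength H (α : LieModule.Weight ℂ H 𝔤)).re)
      (Set.finite_range _).bddAbove α)

theorem normForm_ne_zero (H : LieSubalgebra ℂ 𝔤) [H.IsCartanSubalgebra] : normForm H ≠ 0 := by
  have h1 := longSqLength_pos H
  have h2 : killingForm ℂ 𝔤 ≠ 0 := by
    intro h
    have := LieModule.nontrivial_of_isIrreducible ℂ 𝔤 𝔤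
    obtain ⟨x, hx⟩ := exists_ne (0 : 𝔤)
    exact hx ((LieAlgebra.IsKilling.killingForm_nondegenerate ℂ 𝔤).1 x fun y => by simp [h])
  exact smul_ne_zero (by exact_mod_cast (half_pos h1).ne') h2

end NormalizedForm

/-! ### Finite-dimensionality and the radical vanishing ideal -/

section LoopRepresentation

theorem commutator_mem_of_span {A : Type*} [Ring A] [Algebra ℂ A] {S T : Set A}
    {N : Submodule ℂ A} (h : ∀ x ∈ S, ∀ y ∈ T, x * y - y * x ∈ N) {x y : A}
    (hx : x ∈ Submodule.span ℂ S) (hy : y ∈ Submodule.span ℂ T) : x * y - y * x ∈ N := by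
  induction hx using Submodule.span_induction with
  | mem x hx =>
    induction hy using Submodule.span_induction with
    | mem y hy => exact h x hx y hy
    | zero => simp
    | add u v _ _ hu hv =>
      rw [mul_add, add_mul, add_sub_add_comm]
      exact add_mem hu hv
    | smul c v _ hv =>
      rw [mul_smul_comm, smul_mul_assoc, ← smul_sub]
      exact N.smul_mem c hv
  | zero => simp
  | add u v _ _ hu hv =>
    rw [mul_add, add_mul, add_sub_add_comm]
    exact add_mem hu hv
  | smul c v _ hv =>
    rw [mul_smul_comm, smul_mul_assoc, ← smul_sub]
    exact N.smul_mem c hv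

variable {𝔤 W : Type*} [LieRing 𝔤] [LieAlgebra ℂ 𝔤] [AddCommGroup W] [Module ℂ W]

/-- A representation of a loop algebra, given by the operators `θ f a` of the elements `a ⊗ f`. -/
def IsLoopRep (θ : LaurentPolynomial ℂ →ₗ[ℂ] 𝔤 →ₗ[ℂ] Module.End ℂ W) : Prop :=
  ∀ f g a b, θ f a * θ g b - θ g b * θ f a = θ (f * g) ⁅a, b⁆

/-- The operators of a representation of a loop algebra. -/
def loopRange (θ : LaurentPolynomial ℂ →ₗ[ℂ] 𝔤 →ₗ[ℂ] Module.End ℂ W) :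
    Submodule ℂ (Module.End ℂ W) :=
  Submodule.span ℂ {x | ∃ f a, θ f a = x}

variable {θ : LaurentPolynomial ℂ →ₗ[ℂ] 𝔤 →ₗ[ℂ] Module.End ℂ W}

theorem mem_loopRange (f : LaurentPolynomial ℂ) (a : 𝔤) : θ f a ∈ loopRange θ :=
  Submodule.subset_span ⟨f, a, rfl⟩

theorem commutator_mem_loopRange (hθ : IsLoopRep θ) {x y : Module.End ℂ W} (hx : x ∈ loopRange θ)
    (hy : y ∈ loopRange θ) : x * y - y * x ∈ loopRange θ := by
  refine commutator_mem_of_span ?_ hx hy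
  rintro _ ⟨f, a, rfl⟩ _ ⟨g, b, rfl⟩
  rw [hθ]
  exact mem_loopRange _ _

theorem loopRange_le {N : Submodule ℂ (Module.End ℂ W)}
    (h : ∀ a (n : ℤ), θ (LaurentPolynomial.T n) a ∈ N) : loopRange θ ≤ N := by
  refine Submodule.span_le.2 ?_
  rintro _ ⟨f, a, rfl⟩
  induction f using T_smul_induction with
  | hT n => exact h a n
  | hadd f g hf hg => rw [map_add]; exact add_mem hf hg
  | hsmul c f hf => rw [map_smul]; exact N.smul_mem c hf

/-- For each basis vector of `𝔤` the sequence of its operators satisfies the recurrence given by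
`p`. -/
theorem finiteDimensional_loopRange [FiniteDimensional ℂ 𝔤] {p : Polynomial ℂ} (hp : p ≠ 0)
    (h : ∀ (a : 𝔤) (j : ℤ), (p.sum fun k c => c • θ (LaurentPolynomial.T (j + k)) a) = 0) :
    FiniteDimensional ℂ (loopRange θ) := by
  let b := Module.finBasis ℂ 𝔤
  let V := fun i => Submodule.span ℂ (Set.range fun n : ℤ => θ (LaurentPolynomial.T n) (b i))
  have hV : ∀ i, FiniteDimensional ℂ (V i) := fun i =>
    finiteDimensional_span_of_recurrence hp (h (b i))
  refine Submodule.finiteDimensional_of_le (S₂ := ⨆ i, V i) (loopRange_le fun a n => ?_)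
  rw [← b.sum_repr a, map_sum]
  refine Submodule.sum_mem _ fun i _ => ?_
  rw [map_smul]
  exact Submodule.smul_mem _ _ (Submodule.mem_iSup_of_mem i (Submodule.subset_span ⟨n, rfl⟩))

/-- The elements `a ⊗ f` with `f` in a set on which the representation vanishes generate an ideal
on which it vanishes. -/
theorem IsLoopRep.mul_eq_zero (hθ : IsLoopRep θ)
    (hperf : Submodule.span ℂ {x | ∃ a b : 𝔤, ⁅a, b⁆ = x} = ⊤) {f : LaurentPolynomial ℂ}
    (hf : θ f = 0) (g : LaurentPolynomial ℂ) : θ (f * g) = 0 := by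
  ext1 a
  have ha : a ∈ Submodule.span ℂ {x | ∃ a b : 𝔤, ⁅a, b⁆ = x} := hperf ▸ Submodule.mem_top
  refine Submodule.span_le (p := LinearMap.ker (θ (f * g))).2 ?_ ha
  rintro _ ⟨a, b, rfl⟩
  rw [SetLike.mem_coe, LinearMap.mem_ker, ← hθ, hf]
  simp

/-- The Laurent polynomials `f` for which all elements `a ⊗ f` act as zero. -/
def vanishingIdeal (hθ : IsLoopRep θ)
    (hperf : Submodule.span ℂ {x | ∃ a b : 𝔤, ⁅a, b⁆ = x} = ⊤) : Ideal (LaurentPolynomial ℂ) where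
  carrier := {f | θ f = 0}
  add_mem' := fun {f g} hf hg => by
    change θ (f + g) = 0
    rw [map_add, show θ f = 0 from hf, show θ g = 0 from hg, add_zero]
  zero_mem' := map_zero θ
  smul_mem' := fun g f hf => by
    change θ (g * f) = 0
    rw [mul_comm]
    exact hθ.mul_eq_zero hperf hf g

/-- Only elements of `R` are assumed locally nilpotent. For the remaining `h`, conjugating `f(n)` by
`exp(e(0))` gives the locally nilpotent `f(n) + h(n) - e(n)`, and `h(n)` is a combination of this,
`f(n)` and `e(n)`. -/
theorem span_locallyNilpotent_eq_loopRange (hθ : IsLoopRep θ) {R : Set 𝔤}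
    (hR : ∀ e ∈ R, ∀ n : ℤ, IsLocallyNilpotent (θ (LaurentPolynomial.T n) e))
    (hspan : Submodule.span ℂ (R ∪ {h | ∃ e ∈ R, ∃ f ∈ R, IsSl2Triple h e f}) = ⊤) :
    Submodule.span ℂ {x | x ∈ loopRange θ ∧ IsLocallyNilpotent x} = loopRange θ := by
  set S := Submodule.span ℂ {x | x ∈ loopRange θ ∧ IsLocallyNilpotent x}
  refine le_antisymm (Submodule.span_le.2 fun x hx => hx.1) (loopRange_le fun a n => ?_)
  have hroot : ∀ e ∈ R, ∀ n : ℤ, θ (LaurentPolynomial.T n) e ∈ S := fun e he n =>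
    Submodule.subset_span ⟨mem_loopRange _ _, hR e he n⟩
  have ha : a ∈ Submodule.span ℂ (R ∪ {h | ∃ e ∈ R, ∃ f ∈ R, IsSl2Triple h e f}) :=
    hspan ▸ Submodule.mem_top
  refine Submodule.span_le (p := S.comap (θ (LaurentPolynomial.T n))).2 ?_ ha
  rintro h (he | ⟨e, he, f, hf, ht⟩)
  · exact hroot h he n
  · have h1 : θ (LaurentPolynomial.T 0) e * θ (LaurentPolynomial.T n) f =
        θ (LaurentPolynomial.T n) f * θ (LaurentPolynomial.T 0) e +
          θ (LaurentPolynomial.T n) h := by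
      rw [← sub_eq_iff_eq_add', hθ, ht.lie_e_f, ← LaurentPolynomial.T_add, zero_add]
    have h2 : θ (LaurentPolynomial.T 0) e * θ (LaurentPolynomial.T n) h =
        θ (LaurentPolynomial.T n) h * θ (LaurentPolynomial.T 0) e +
          θ (LaurentPolynomial.T n) ((-2 : ℂ) • e) := by
      rw [← sub_eq_iff_eq_add', hθ, ← lie_skew, ht.lie_h_e_smul ℂ, ← LaurentPolynomial.T_add,
        zero_add, neg_smul]
    have h3 : θ (LaurentPolynomial.T 0) e * θ (LaurentPolynomial.T n) ((-2 : ℂ) • e) =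
        θ (LaurentPolynomial.T n) ((-2 : ℂ) • e) * θ (LaurentPolynomial.T 0) e := by
      rw [← sub_eq_zero, hθ, lie_smul, lie_self, smul_zero, map_zero]
    have h4 := isLocallyNilpotent_exp_conj (hR e he 0) (hR f hf n) h1 h2 h3
    have h5 : θ (LaurentPolynomial.T n) f + θ (LaurentPolynomial.T n) h +
        (1 / 2 : ℂ) • θ (LaurentPolynomial.T n) ((-2 : ℂ) • e) =
        θ (LaurentPolynomial.T n) (f + h - e) := by
      rw [map_smul, smul_smul, map_sub, map_add]
      norm_num
      abel
    rw [h5] at h4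
    have h6 : h = (f + h - e) - f + e := by abel
    change θ (LaurentPolynomial.T n) h ∈ S
    rw [h6, map_add, map_sub]
    exact add_mem (sub_mem (Submodule.subset_span ⟨mem_loopRange _ _, h4⟩) (hroot f hf n))
      (hroot e he n)

/-- Irreducibility under the operators of a representation of a loop algebra. -/
def IsLoopIrreducible (θ : LaurentPolynomial ℂ →ₗ[ℂ] 𝔤 →ₗ[ℂ] Module.End ℂ W) : Prop :=
  ∀ N : Submodule ℂ W, (∀ f a, ∀ w ∈ N, θ f a w ∈ N) → N = ⊥ ∨ N = ⊤

/-- A finite spanning set of locally nilpotent operators puts a nonzero vector into a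
finite-dimensional stable subspace, which is all of `W` by irreducibility. -/
theorem finiteDimensional_of_span_locallyNilpotent (hθ : IsLoopRep θ) (hirr : IsLoopIrreducible θ)
    [FiniteDimensional ℂ (loopRange θ)]
    (hspan : Submodule.span ℂ {x | x ∈ loopRange θ ∧ IsLocallyNilpotent x} = loopRange θ) :
    FiniteDimensional ℂ W := by
  rcases subsingleton_or_nontrivial W with hW | hW
  · infer_instance
  obtain ⟨w, hw⟩ := exists_ne (0 : W)
  have hfg : (loopRange θ).FG := Submodule.fg_iff_finiteDimensional _ |>.2 inferInstance
  rw [← hspan] at hfg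
  obtain ⟨s, hs, hs'⟩ := (Submodule.fg_span_iff_fg_span_finset_subset _).1 hfg
  rw [hspan] at hs'
  have hrange : Set.range (fun x : s => (x : Module.End ℂ W)) = s := Subtype.range_coe
  obtain ⟨V, hV, hwV, hstab⟩ := exists_finiteDimensional_stable (w := w)
    (x := fun x : s => (x : Module.End ℂ W))
    (fun i j => by
      rw [hrange, ← hs']
      exact commutator_mem_loopRange hθ (hs i.2).1 (hs j.2).1)
    (fun i => (hs i.2).2 w)
  have hVtop : V = ⊤ := by
    refine (hirr V fun f a v hv => ?_).resolve_left fun h => hw (by simpa [h] using hwV)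
    have h1 : θ f a ∈ Submodule.span ℂ (s : Set (Module.End ℂ W)) := hs' ▸ mem_loopRange f a
    generalize θ f a = y at h1
    induction h1 using Submodule.span_induction with
    | mem x hx => exact hstab ⟨x, hx⟩ v hv
    | zero => exact V.zero_mem
    | add x y _ _ hx hy => exact add_mem hx hy
    | smul c x _ hx => exact V.smul_mem c hx
  rw [hVtop] at hV
  exact Module.finite_def.2 (Module.Finite.iff_fg.1 hV)

/-- The operators of a representation of a loop algebra, as a Lie algebra. -/
def loopRangeLie (hθ : IsLoopRep θ) : LieSubalgebra ℂ (Module.End ℂ W) where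
  __ := loopRange θ
  lie_mem' := fun hx hy => commutator_mem_loopRange hθ hx hy

/-- The ideal of operators `a ⊗ fg` for a fixed `f`. -/
def loopIdeal (hθ : IsLoopRep θ) (f : LaurentPolynomial ℂ) : LieIdeal ℂ (loopRangeLie hθ) where
  __ := (Submodule.span ℂ {x | ∃ g a, θ (f * g) a = x}).comap
    (loopRangeLie hθ).toSubmodule.subtype
  lie_mem := by
    intro x y hy
    change (x : Module.End ℂ W) * (y : Module.End ℂ W) - (y : Module.End ℂ W) * (x : Module.End ℂ W) ∈
      Submodule.span ℂ {x | ∃ g a, θ (f * g) a = x}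
    refine commutator_mem_of_span ?_ x.2 hy
    rintro _ ⟨g, a, rfl⟩ _ ⟨g', b, rfl⟩
    rw [hθ, mul_left_comm]
    exact Submodule.subset_span ⟨_, _, rfl⟩

/-- In an irreducible finite-dimensional representation the vanishing ideal is radical. -/
theorem eq_zero_of_mul_self_eq_zero [FiniteDimensional ℂ W] [Nontrivial W] (hθ : IsLoopRep θ)
    (hperf : Submodule.span ℂ {x | ∃ a b : 𝔤, ⁅a, b⁆ = x} = ⊤) (hirr : IsLoopIrreducible θ)
    {f : LaurentPolynomial ℂ} (hf : θ (f * f) = 0) : θ f = 0 := by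
  let L := loopRangeLie hθ
  have hL : LieModule.IsIrreducible ℂ L W := LieModule.IsIrreducible.mk fun N hN => by
    have := (hirr N.toSubmodule fun f a w hw => N.lie_mem (x := ⟨θ f a, mem_loopRange f a⟩) hw)
    simpa [hN] using this
  have hcr := (LieAlgebra.hasCentralRadical_and_of_isIrreducible_of_isFaithful ℂ L W).1
  let J := loopIdeal hθ f
  -- Brackets in `J` lie in `𝔤 ⊗ f²ℂ[t,t⁻¹]`, which acts as zero. So `J` is a solvable ideal, hence
  -- central, and `[a ⊗ 1, b ⊗ f] = [a, b] ⊗ f` acts as zero; perfectness of `𝔤` does the rest.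
  have hJ : IsLieAbelian J := by
    refine ⟨fun x y => Subtype.ext (Subtype.ext ?_)⟩
    have h1 : ((x : L) : Module.End ℂ W) * ((y : L) : Module.End ℂ W) -
        ((y : L) : Module.End ℂ W) * ((x : L) : Module.End ℂ W) ∈
          (⊥ : Submodule ℂ (Module.End ℂ W)) := by
      refine commutator_mem_of_span ?_ x.2 y.2
      rintro _ ⟨g, a, rfl⟩ _ ⟨g', b, rfl⟩
      rw [hθ, mul_mul_mul_comm, hθ.mul_eq_zero hperf hf]
      simp
    exact (Submodule.mem_bot ℂ).1 h1
  have hJc : J ≤ LieAlgebra.center ℂ L := by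
    rw [← hcr.radical_eq_center]
    exact (LieAlgebra.LieIdeal.solvable_iff_le_radical ℂ L J).1 inferInstance
  ext1 a
  have ha : a ∈ Submodule.span ℂ {x | ∃ a b : 𝔤, ⁅a, b⁆ = x} := hperf ▸ Submodule.mem_top
  refine Submodule.span_le (p := LinearMap.ker (θ f)).2 ?_ ha
  rintro _ ⟨a, b, rfl⟩
  rw [SetLike.mem_coe, LinearMap.mem_ker]
  have hb : (⟨θ f b, mem_loopRange f b⟩ : L) ∈ J :=
    Submodule.subset_span ⟨1, b, by rw [mul_one]; rfl⟩
  have h2 := (LieModule.mem_maxTrivSubmodule ℂ L L _).1 (hJc hb) ⟨θ 1 a, mem_loopRange 1 a⟩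
  have h3 : θ 1 a * θ f b - θ f b * θ 1 a = 0 := congrArg Subtype.val h2
  rwa [hθ, one_mul] at h3

end LoopRepresentation

/-! ### Evaluation points and Lagrange idempotents -/

section Points

variable {𝔤 W : Type*} [LieRing 𝔤] [LieAlgebra ℂ 𝔤] [AddCommGroup W] [Module ℂ W]
  {θ : LaurentPolynomial ℂ →ₗ[ℂ] 𝔤 →ₗ[ℂ] Module.End ℂ W}

theorem toLaurent_eq_sum (p : Polynomial ℂ) :
    p.toLaurent = p.sum fun k c => c • (LaurentPolynomial.T k : LaurentPolynomial ℂ) := by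
  conv_lhs => rw [p.as_sum_support_C_mul_X_pow]
  rw [map_sum, Polynomial.sum_def]
  refine Finset.sum_congr rfl fun k _ => ?_
  rw [Polynomial.toLaurent_C_mul_X_pow, LaurentPolynomial.smul_eq_C_mul]

/-- A radical ideal containing `p` contains the product over the distinct roots of `p`; the root `0`
can be dropped because `t` is a unit. -/
theorem exists_points_of_ne_zero {I : Ideal (LaurentPolynomial ℂ)} (hI : I.IsRadical)
    {p : Polynomial ℂ} (hp : p ≠ 0) (hpI : p.toLaurent ∈ I) :
    ∃ (r : ℕ) (_ : 1 ≤ r) (z : Fin r → ℂˣ), Function.Injective z ∧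
      (∏ i, (Polynomial.X - Polynomial.C (z i : ℂ))).toLaurent ∈ I := by
  classical
  -- The extra point `1` guarantees `r ≥ 1`; a superfluous factor does not leave the ideal.
  let Z : Finset ℂˣ := insert 1 (p.roots.toFinset.preimage Units.val Units.val_injective.injOn)
  let q : Polynomial ℂ := ∏ z ∈ Z, (Polynomial.X - Polynomial.C (z : ℂ))
  have hroot : ∀ a : ℂ, p.IsRoot a → Polynomial.X - Polynomial.C a ∣ Polynomial.X * q := by
    intro a ha
    by_cases ha0 : a = 0
    · rw [ha0, Polynomial.C_0, sub_zero]
      exact dvd_mul_right _ _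
    · refine Dvd.dvd.mul_left (Finset.dvd_prod_of_mem
        (fun z : ℂˣ => Polynomial.X - Polynomial.C (z : ℂ)) (a := Units.mk0 a ha0) ?_) _
      simp only [Z, Finset.mem_insert, Finset.mem_preimage, Multiset.mem_toFinset]
      exact Or.inr ((Polynomial.mem_roots hp).2 ha)
  have hdvd : p ∣ (Polynomial.X * q) ^ p.roots.card := by
    rw [(IsAlgClosed.splits p).eq_prod_roots]
    rw [(Polynomial.isUnit_C.2 (isUnit_iff_ne_zero.2 (Polynomial.leadingCoeff_ne_zero.2 hp))).mul_left_dvd]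
    rw [← (IsAlgClosed.splits p).eq_prod_roots, ← Multiset.prod_replicate, ← Multiset.map_const']
    exact Multiset.prod_dvd_prod_of_dvd _ _ fun a ha => hroot a (Polynomial.isRoot_of_mem_roots ha)
  have hq : q.toLaurent ∈ I := by
    obtain ⟨s, hs⟩ := hdvd
    have h1 : ((Polynomial.X * q) ^ p.roots.card).toLaurent ∈ I := by
      rw [hs, map_mul]
      exact I.mul_mem_right _ hpI
    rw [map_pow] at h1
    have h2 := hI ⟨_, h1⟩
    rw [map_mul, Polynomial.toLaurent_X] at h2
    have h3 := I.mul_mem_left (LaurentPolynomial.T (-1)) h2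
    rwa [← mul_assoc, ← LaurentPolynomial.T_add, neg_add_cancel, LaurentPolynomial.T_zero,
      one_mul] at h3
  refine ⟨Z.card, Finset.card_pos.2 ⟨1, Finset.mem_insert_self _ _⟩,
    fun i => (Z.equivFin.symm i : ℂˣ), Subtype.val_injective.comp Z.equivFin.symm.injective, ?_⟩
  have h4 : ∏ i, (Polynomial.X - Polynomial.C ((Z.equivFin.symm i : ℂˣ) : ℂ)) = q := by
    rw [Equiv.prod_comp Z.equivFin.symm fun z : Z => Polynomial.X - Polynomial.C ((z : ℂˣ) : ℂ)]
    exact Finset.prod_coe_sort Z fun z : ℂˣ => Polynomial.X - Polynomial.C (z : ℂ)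
  exact h4 ▸ hq

variable {r : ℕ} {z : Fin r → ℂˣ}

theorem toLaurent_mem_of_eval_eq_zero {I : Ideal (LaurentPolynomial ℂ)}
    (hz : Function.Injective z)
    (hI : (∏ i, (Polynomial.X - Polynomial.C (z i : ℂ))).toLaurent ∈ I) {p : Polynomial ℂ}
    (hp : ∀ i, p.eval (z i : ℂ) = 0) : p.toLaurent ∈ I := by
  have hdvd : ∏ i, (Polynomial.X - Polynomial.C (z i : ℂ)) ∣ p :=
    Finset.prod_dvd_of_coprime
      (fun i _ j _ hij => Polynomial.pairwise_coprime_X_sub_C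
        (Units.val_injective.comp hz) hij)
      fun i _ => Polynomial.dvd_iff_isRoot.2 (hp i)
  obtain ⟨s, rfl⟩ := hdvd
  rw [map_mul]
  exact I.mul_mem_right _ hI

/-- The interpolation polynomials of the points `z i`, as Laurent polynomials. -/
def lagrangeLaurent (z : Fin r → ℂˣ) (i : Fin r) : LaurentPolynomial ℂ :=
  (Lagrange.basis Finset.univ (fun j => (z j : ℂ)) i).toLaurent

theorem eval_lagrange_basis (hz : Function.Injective z) (i j : Fin r) :
    (Lagrange.basis Finset.univ (fun j => (z j : ℂ)) i).eval (z j : ℂ) =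
      if i = j then 1 else 0 := by
  split_ifs with h
  · subst h
    exact Lagrange.eval_basis_self (v := fun j => (z j : ℂ))
      (Units.val_injective.comp hz).injOn (Finset.mem_univ _)
  · exact Lagrange.eval_basis_of_ne (v := fun j => (z j : ℂ)) h (Finset.mem_univ _)

/-- Modulo `I` the Lagrange polynomials are orthogonal idempotents, since both sides agree at every
`z i`. Idempotency makes each `pointRep` a representation, orthogonality makes different ones
commute. -/
theorem lagrangeLaurent_mul_sub_mem {I : Ideal (LaurentPolynomial ℂ)} (hz : Function.Injective z)
    (hI : (∏ i, (Polynomial.X - Polynomial.C (z i : ℂ))).toLaurent ∈ I) (i j : Fin r) :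
    lagrangeLaurent z i * lagrangeLaurent z j -
      (if i = j then lagrangeLaurent z i else 0) ∈ I := by
  have h := toLaurent_mem_of_eval_eq_zero hz hI
    (p := Lagrange.basis Finset.univ (fun j => (z j : ℂ)) i *
      Lagrange.basis Finset.univ (fun j => (z j : ℂ)) j -
        if i = j then Lagrange.basis Finset.univ (fun j => (z j : ℂ)) i else 0) (by
      intro k
      by_cases hij : i = j
      · subst hij
        by_cases hik : i = k <;> simp [eval_lagrange_basis hz, hik]
      · by_cases hik : i = k
        · subst hik
          simp [eval_lagrange_basis hz, hij, Ne.symm hij]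
        · simp [eval_lagrange_basis hz, hij, hik])
  rw [map_sub, map_mul] at h
  by_cases hij : i = j
  · simpa [hij, lagrangeLaurent] using h
  · simpa [hij, lagrangeLaurent] using h

theorem T_sub_sum_lagrangeLaurent_mem {I : Ideal (LaurentPolynomial ℂ)}
    (hz : Function.Injective z)
    (hI : (∏ i, (Polynomial.X - Polynomial.C (z i : ℂ))).toLaurent ∈ I) (n : ℤ) :
    LaurentPolynomial.T n - ∑ i, ((z i : ℂ) ^ n) • lagrangeLaurent z i ∈ I := by
  -- Multiplying by `tᵏ` clears negative powers, so that the claim can be tested on polynomial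
  -- values.
  obtain ⟨m, k, rfl⟩ : ∃ m k : ℕ, n = m - k := ⟨n.toNat, (-n).toNat, by omega⟩
  have h := toLaurent_mem_of_eval_eq_zero hz hI
    (p := Polynomial.X ^ m - Polynomial.X ^ k *
      ∑ i, ((z i : ℂ) ^ ((m : ℤ) - k)) • Lagrange.basis Finset.univ (fun j => (z j : ℂ)) i) (by
      intro j
      simp [Polynomial.eval_finsetSum, eval_lagrange_basis hz, zpow_sub₀]
      field_simp
      simp)
  have h2 := I.mul_mem_left (LaurentPolynomial.T (-k)) h
  rw [map_sub, map_mul, map_pow, map_pow, Polynomial.toLaurent_X, LaurentPolynomial.T_pow,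
    LaurentPolynomial.T_pow, mul_sub, ← mul_assoc, ← LaurentPolynomial.T_add,
    ← LaurentPolynomial.T_add, map_sum] at h2
  have h3 : ∀ (c : ℂ) (s : Polynomial ℂ), (c • s).toLaurent = c • s.toLaurent := by
    intro c s
    rw [Polynomial.smul_eq_C_mul, map_mul, Polynomial.toLaurent_C, LaurentPolynomial.smul_eq_C_mul]
  simp only [h3, mul_one, neg_add_cancel, LaurentPolynomial.T_zero, one_mul] at h2
  rwa [neg_add_eq_sub] at h2

/-- The representation of `𝔤` at the point `z i`. -/
def pointRep (hθ : IsLoopRep θ)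
    (hperf : Submodule.span ℂ {x | ∃ a b : 𝔤, ⁅a, b⁆ = x} = ⊤) (hz : Function.Injective z)
    (hI : (∏ i, (Polynomial.X - Polynomial.C (z i : ℂ))).toLaurent ∈ vanishingIdeal hθ hperf)
    (i : Fin r) : 𝔤 →ₗ⁅ℂ⁆ Module.End ℂ W where
  __ := θ (lagrangeLaurent z i)
  map_lie' := fun {a b} => by
    have h : θ (lagrangeLaurent z i * lagrangeLaurent z i - lagrangeLaurent z i) = 0 := by
      have := lagrangeLaurent_mul_sub_mem hz hI i i
      rwa [if_pos rfl] at this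
    rw [map_sub, sub_eq_zero] at h
    exact (LinearMap.congr_fun h ⁅a, b⁆).symm.trans (hθ _ _ a b).symm

theorem commute_pointRep (hθ : IsLoopRep θ)
    (hperf : Submodule.span ℂ {x | ∃ a b : 𝔤, ⁅a, b⁆ = x} = ⊤) (hz : Function.Injective z)
    (hI : (∏ i, (Polynomial.X - Polynomial.C (z i : ℂ))).toLaurent ∈ vanishingIdeal hθ hperf)
    {i j : Fin r} (hij : i ≠ j) (a b : 𝔤) :
    Commute (pointRep hθ hperf hz hI i a) (pointRep hθ hperf hz hI j b) := by
  have h : θ (lagrangeLaurent z i * lagrangeLaurent z j) = 0 := by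
    have := lagrangeLaurent_mul_sub_mem hz hI i j
    rwa [if_neg hij, sub_zero] at this
  refine sub_eq_zero.1 ((hθ (lagrangeLaurent z i) (lagrangeLaurent z j) a b).trans ?_)
  rw [h]
  rfl

theorem apply_T_eq_sum_pointRep (hθ : IsLoopRep θ)
    (hperf : Submodule.span ℂ {x | ∃ a b : 𝔤, ⁅a, b⁆ = x} = ⊤) (hz : Function.Injective z)
    (hI : (∏ i, (Polynomial.X - Polynomial.C (z i : ℂ))).toLaurent ∈ vanishingIdeal hθ hperf)
    (n : ℤ) (a : 𝔤) :
    θ (LaurentPolynomial.T n) a = ∑ i, ((z i : ℂ) ^ n) • pointRep hθ hperf hz hI i a := by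
  have h : θ (LaurentPolynomial.T n - ∑ i, ((z i : ℂ) ^ n) • lagrangeLaurent z i) = 0 :=
    T_sub_sum_lagrangeLaurent_mem hz hI n
  rw [map_sub, sub_eq_zero] at h
  rw [h, map_sum, LinearMap.sum_apply]
  refine Finset.sum_congr rfl fun i _ => ?_
  rw [map_smul]
  rfl

end Points

/-! ### Commuting representations and equivariant multilinear maps -/

section Multilinear

/-- A finite-dimensional irreducible representation in coordinates. -/
structure IrrRep (𝔤 : Type*) [LieRing 𝔤] [LieAlgebra ℂ 𝔤] where
  /-- The dimension. -/
  dim : ℕ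
  /-- The action. -/
  rep : 𝔤 →ₗ⁅ℂ⁆ Module.End ℂ (Fin dim → ℂ)
  dim_ne_zero : dim ≠ 0
  irreducible : ∀ N : Submodule ℂ (Fin dim → ℂ), (∀ a, ∀ u ∈ N, rep a u ∈ N) → N = ⊥ ∨ N = ⊤

variable {𝔤 : Type*} [LieRing 𝔤] [LieAlgebra ℂ 𝔤]

/-- A minimal nonzero invariant subspace is irreducible; a basis transports it to coordinates. -/
theorem exists_irrRep_embedding {W : Type*} [AddCommGroup W] [Module ℂ W] [FiniteDimensional ℂ W]
    [Nontrivial W] (ρ : 𝔤 →ₗ⁅ℂ⁆ Module.End ℂ W) :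
    ∃ (U : IrrRep 𝔤) (e : (Fin U.dim → ℂ) →ₗ[ℂ] W), e ≠ 0 ∧ ∀ a u, e (U.rep a u) = ρ a (e u) := by
  obtain ⟨N, ⟨hN0, hN⟩, hmin⟩ := WellFounded.has_min (wellFounded_lt (α := Submodule ℂ W))
    {N | N ≠ ⊥ ∧ ∀ a, ∀ w ∈ N, ρ a w ∈ N} ⟨⊤, top_ne_bot, fun _ _ _ => Submodule.mem_top⟩
  let φ : N ≃ₗ[ℂ] (Fin (Module.finrank ℂ N) → ℂ) := (Module.finBasis ℂ N).equivFun
  let e : (Fin (Module.finrank ℂ N) → ℂ) →ₗ[ℂ] W := N.subtype ∘ₗ φ.symm.toLinearMap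
  have he : Function.Injective e := Subtype.val_injective.comp φ.symm.injective
  let R : 𝔤 → Module.End ℂ (Fin (Module.finrank ℂ N) → ℂ) := fun a =>
    φ.toLinearMap ∘ₗ (ρ a).restrict (hN a) ∘ₗ φ.symm.toLinearMap
  have hR : ∀ a u, e (R a u) = ρ a (e u) := fun a u => by simp [e, R]
  have hrank : Module.finrank ℂ N ≠ 0 := fun h => hN0 (Submodule.finrank_eq_zero.1 h)
  refine ⟨⟨Module.finrank ℂ N,
    { toFun := R
      map_add' := fun a b => LinearMap.ext fun u => he (by simp [hR])
      map_smul' := fun c a => LinearMap.ext fun u => he (by simp [hR])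
      map_lie' := fun {a b} => LinearMap.ext fun u => he (by
        rw [hR, LieHom.map_lie]
        simp [LieRing.of_associative_ring_bracket, hR]) }, hrank, ?_⟩, e, ?_, hR⟩
  · intro M hM
    by_cases hM0 : M = ⊥
    · exact Or.inl hM0
    refine Or.inr ?_
    have h1 : M.map e ≤ N := by
      rintro _ ⟨u, _, rfl⟩
      exact (φ.symm u).2
    have h2 : M.map e = N := by
      refine h1.eq_of_not_lt fun hlt => hmin _ ⟨?_, ?_⟩ hlt
      · exact fun h => hM0 (Submodule.map_injective_of_injective he (h.trans (Submodule.map_bot e).symm))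
      · rintro a _ ⟨u, hu, rfl⟩
        exact ⟨R a u, hM a u hu, hR a u⟩
    refine eq_top_iff.2 fun u _ => ?_
    obtain ⟨v, hv, hvu⟩ : e u ∈ M.map e := by rw [h2]; exact (φ.symm u).2
    exact he hvu ▸ hv
  · intro h0
    have : Nonempty (Fin (Module.finrank ℂ N)) := Fin.pos_iff_nonempty.1 (Nat.pos_of_ne_zero hrank)
    obtain ⟨u, hu⟩ := exists_ne (0 : Fin (Module.finrank ℂ N) → ℂ)
    exact hu (he (by rw [h0]; rfl))

/-- Commuting representations of `𝔤` on a nonzero finite-dimensional space admit a nonzero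
equivariant multilinear map from a product of irreducible representations. -/
theorem exists_equivariant_multilinearMap (n : ℕ) : ∀ (W : Type*) [AddCommGroup W] [Module ℂ W]
    [FiniteDimensional ℂ W] [Nontrivial W] (ρ : Fin n → 𝔤 →ₗ⁅ℂ⁆ Module.End ℂ W)
    (_ : ∀ i j, i ≠ j → ∀ a b, Commute (ρ i a) (ρ j b)),
    ∃ (U : Fin n → IrrRep 𝔤) (F : MultilinearMap ℂ (fun i => Fin (U i).dim → ℂ) W), F ≠ 0 ∧
      ∀ i a u, F (Function.update u i ((U i).rep a (u i))) = ρ i a (F u) := by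
  induction n with
  | zero =>
    intro W _ _ _ _ ρ _
    obtain ⟨w, hw⟩ := exists_ne (0 : W)
    exact ⟨fun i => i.elim0, MultilinearMap.constOfIsEmpty ℂ _ w,
      fun h => hw (by simpa using congrArg (fun F => F fun i => i.elim0) h), fun i => i.elim0⟩
  | succ n ih =>
    intro W _ _ _ _ ρ hρ
    obtain ⟨U₀, e, he0, he⟩ := exists_irrRep_embedding (ρ 0)
    -- `M = Hom_𝔤(U₀, W)` for `ρ 0`. The other representations commute with `ρ 0`, so they act on
    -- `M` by composition and the induction applies to `M`. With `U₀` in coordinates, `M` stays in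
    -- the universe of `W`.
    let M : Submodule ℂ ((Fin U₀.dim → ℂ) →ₗ[ℂ] W) :=
      { carrier := {φ | ∀ a u, φ (U₀.rep a u) = ρ 0 a (φ u)}
        add_mem' := fun hφ hψ a u => by simp [hφ a u, hψ a u]
        zero_mem' := fun a u => by simp
        smul_mem' := fun c φ hφ a u => by simp [hφ a u] }
    have hM : Nontrivial M := ⟨⟨⟨e, he⟩, 0, fun h => he0 (congrArg Subtype.val h)⟩⟩
    let σ : Fin n → 𝔤 →ₗ⁅ℂ⁆ Module.End ℂ M := fun i =>
      { toFun := fun a =>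
          { toFun := fun φ => ⟨ρ i.succ a ∘ₗ φ.1, fun b u => by
              have := LinearMap.congr_fun (hρ i.succ 0 (Fin.succ_ne_zero i) a b).eq (φ.1 u)
              simpa [φ.2 b u] using this⟩
            map_add' := fun φ ψ => Subtype.ext (LinearMap.comp_add _ _ _)
            map_smul' := fun c φ => Subtype.ext (LinearMap.comp_smul _ _ _) }
        map_add' := fun a b => LinearMap.ext fun φ => Subtype.ext (LinearMap.ext fun u => by
          simp)
        map_smul' := fun c a => LinearMap.ext fun φ => Subtype.ext (LinearMap.ext fun u => by
          simp)
        map_lie' := fun {a b} => LinearMap.ext fun φ => Subtype.ext (LinearMap.ext fun u => by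
          simp [LieRing.of_associative_ring_bracket]) }
    have hσ : ∀ i a (φ : M) u, (σ i a φ).1 u = ρ i.succ a (φ.1 u) := fun _ _ _ _ => rfl
    obtain ⟨U, G, hG0, hG⟩ := ih M σ fun i j hij a b => by
      refine LinearMap.ext fun φ => Subtype.ext (LinearMap.ext fun u => ?_)
      exact LinearMap.congr_fun (hρ i.succ j.succ (fun h => hij (Fin.succ_injective _ h)) a b).eq
        (φ.1 u)
    let f : (Fin U₀.dim → ℂ) →ₗ[ℂ] MultilinearMap ℂ (fun i => Fin (U i).dim → ℂ) W :=
      { toFun := fun x => ((LinearMap.applyₗ x) ∘ₗ M.subtype).compMultilinearMap G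
        map_add' := fun x y => by ext; simp
        map_smul' := fun c x => by ext; simp }
    have hf : ∀ x v, f x v = (G v).1 x := fun _ _ => rfl
    -- The new map is `F(u₀, v) = G(v)(u₀)`: equivariance in the first slot is membership in `M`, in
    -- the others it is inherited from `G`.
    let U' : Fin (n + 1) → IrrRep 𝔤 := Fin.cons U₀ U
    let F : MultilinearMap ℂ (fun i => Fin (U' i).dim → ℂ) W :=
      LinearMap.uncurryLeft (M := fun i => Fin (U' i).dim → ℂ) f
    have hF : ∀ u : (∀ i, Fin (U' i).dim → ℂ), F u = (G (Fin.tail u)).1 (u 0) := fun _ => rfl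
    refine ⟨U', F, ?_, ?_⟩
    · intro h0
      refine hG0 (MultilinearMap.ext fun v => Subtype.ext (LinearMap.ext fun x => ?_))
      exact congrArg (fun F => F (Fin.cons (α := fun i => Fin (U' i).dim → ℂ) x v)) h0
    · intro i a u
      rw [hF, hF]
      induction i using Fin.cases with
      | zero =>
        rw [Fin.tail_update_zero, Function.update_self]
        exact (G (Fin.tail u)).2 a (u 0)
      | succ i =>
        rw [Fin.tail_update_succ, Function.update_of_ne (Fin.succ_ne_zero i).symm]
        exact congrArg (fun φ : M => φ.1 (u 0)) (hG i a (Fin.tail u))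

end Multilinear

/-! ### Evaluation modules -/

section Evaluation

variable {𝔤 : Type*} [LieRing 𝔤] [LieAlgebra ℂ 𝔤]
  (Φ : LinearMap.BilinForm ℂ 𝔤) (hΦ : Φ.lieInvariant 𝔤) (hΦs : Φ.IsSymm)
  {r : ℕ} (z : Fin r → ℂˣ) (U : Fin r → Type*) [∀ i, AddCommGroup (U i)] [∀ i, Module ℂ (U i)]
  [∀ i, LieRingModule 𝔤 (U i)] [∀ i, LieModule ℂ 𝔤 (U i)]

/-- The operator of an element of `𝔤` on `U(z)`. -/
def evalOp (i : Fin r) (a : 𝔤) : Module.End ℂ (Eval (z i) (U i)) :=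
  LieModule.toEnd ℂ 𝔤 (U i) a

theorem toEnd_loopElt_eval (i : Fin r) (a : 𝔤) (n : ℤ) :
    LieModule.toEnd ℂ (Affine Φ hΦ hΦs) (Eval (z i) (U i)) (loopElt Φ hΦ hΦs a n) =
      ((z i : ℂ) ^ n) • evalOp z U i a :=
  LinearMap.ext fun u => loopElt_lie_eval Φ hΦ hΦs (z i) (U i) a n u

theorem toEnd_loopElt_tensor (a : 𝔤) (n : ℤ) :
    LieModule.toEnd ℂ (Affine Φ hΦ hΦs) (⨂[ℂ] i, Eval (z i) (U i)) (loopElt Φ hΦ hΦs a n) =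
      ∑ i, ((z i : ℂ) ^ n) • factorEnd (fun i => Eval (z i) (U i)) i (evalOp z U i a) := by
  have h : LieModule.toEnd ℂ (Affine Φ hΦ hΦs) (⨂[ℂ] i, Eval (z i) (U i))
      (loopElt Φ hΦ hΦs a n) = tensorAct (fun i => Eval (z i) (U i)) (loopElt Φ hΦ hΦs a n) :=
    LinearMap.ext fun _ => rfl
  rw [h, tensorAct]
  refine Finset.sum_congr rfl fun i _ => ?_
  rw [toEnd_loopElt_eval, factorEnd_smul]

theorem toEnd_central_tensor :
    LieModule.toEnd ℂ (Affine Φ hΦ hΦs) (⨂[ℂ] i, Eval (z i) (U i)) (central Φ hΦ hΦs) = 0 := by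
  have h : LieModule.toEnd ℂ (Affine Φ hΦ hΦs) (⨂[ℂ] i, Eval (z i) (U i))
      (central Φ hΦ hΦs) = tensorAct (fun i => Eval (z i) (U i)) (central Φ hΦ hΦs) :=
    LinearMap.ext fun _ => rfl
  rw [h, tensorAct]
  refine Finset.sum_eq_zero fun i _ => ?_
  have h0 : LieModule.toEnd ℂ (Affine Φ hΦ hΦs) (Eval (z i) (U i)) (central Φ hΦ hΦs) = 0 :=
    LinearMap.ext fun u => central_lie_eval Φ hΦ hΦs u
  rw [h0, factorEnd_zero]

theorem loopAct_toLaurent_tensor (p : Polynomial ℂ) (a : 𝔤) :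
    loopAct Φ hΦ hΦs (⨂[ℂ] i, Eval (z i) (U i)) p.toLaurent a =
      ∑ i, p.eval (z i : ℂ) • factorEnd (fun i => Eval (z i) (U i)) i (evalOp z U i a) := by
  rw [toLaurent_eq_sum, Polynomial.sum_def, map_sum, LinearMap.sum_apply]
  simp only [map_smul, LinearMap.smul_apply, loopAct_T, toEnd_loopElt_tensor, Finset.smul_sum,
    smul_smul, zpow_natCast]
  rw [Finset.sum_comm]
  refine Finset.sum_congr rfl fun i _ => ?_
  rw [← Finset.sum_smul, Polynomial.eval_eq_sum, Polynomial.sum_def]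

theorem loopAct_mem {W : Type*} [AddCommGroup W] [Module ℂ W] [LieRingModule (Affine Φ hΦ hΦs) W]
    [LieModule ℂ (Affine Φ hΦ hΦs) W] (N : LieSubmodule ℂ (Affine Φ hΦ hΦs) W)
    (f : LaurentPolynomial ℂ) (a : 𝔤) {w : W} (hw : w ∈ N) : loopAct Φ hΦ hΦs W f a w ∈ N :=
  N.lie_mem hw

/-- Evaluation modules of irreducible modules at distinct points are irreducible. -/
theorem isIrreducible_tensor [∀ i, FiniteDimensional ℂ (U i)]
    (hU : ∀ i, LieModule.IsIrreducible ℂ 𝔤 (U i)) (hz : Function.Injective z) :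
    LieModule.IsIrreducible ℂ (Affine Φ hΦ hΦs) (⨂[ℂ] i, Eval (z i) (U i)) := by
  have hfin : ∀ i, FiniteDimensional ℂ (Eval (z i) (U i)) := fun i =>
    inferInstanceAs (FiniteDimensional ℂ (U i))
  have hnon : ∀ i, Nontrivial (Eval (z i) (U i)) := fun i =>
    LieModule.nontrivial_of_isIrreducible ℂ 𝔤 (U i)
  have hnt : Nontrivial (⨂[ℂ] i, Eval (z i) (U i)) := by
    let B := Basis.piTensorProduct fun i => Module.finBasis ℂ (Eval (z i) (U i))
    exact ⟨⟨B fun i => ⟨0, Module.finrank_pos⟩, 0, B.ne_zero _⟩⟩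
  have hadj : ∀ i, Algebra.adjoin ℂ (Set.range (evalOp (𝔤 := 𝔤) z U i)) = ⊤ := by
    intro i
    refine adjoin_eq_top_of_irreducible _ fun N hN => ?_
    let N' : LieSubmodule ℂ 𝔤 (U i) :=
      { N with lie_mem := fun {a u} hu => hN _ ⟨a, rfl⟩ u hu }
    rcases (hU i).eq_bot_or_eq_top N' with h | h
    · exact Or.inl (congrArg LieSubmodule.toSubmodule h)
    · exact Or.inr (congrArg LieSubmodule.toSubmodule h)
  refine LieModule.IsIrreducible.mk fun N hN => ?_
  have h := eq_bot_or_eq_top_of_factorEnd_mem (N := N.toSubmodule)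
    (fun i => Set.range (evalOp (𝔤 := 𝔤) z U i)) hadj (by
      rintro i _ ⟨a, rfl⟩ m hm
      -- The Lagrange polynomial is `1` at `z i` and `0` at the other points, so `a ⊗ f` acts as `a`
      -- on the `i`-th factor alone.
      have h1 := loopAct_mem Φ hΦ hΦs N (lagrangeLaurent z i) a hm
      rw [lagrangeLaurent, loopAct_toLaurent_tensor] at h1
      simpa [eval_lagrange_basis hz] using h1)
  simpa [hN] using h

theorem isNilpotent_toEnd_loopElt_tensor {a : 𝔤}
    (ha : ∀ i, IsNilpotent (LieModule.toEnd ℂ 𝔤 (U i) a)) (n : ℤ) :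
    IsNilpotent (LieModule.toEnd ℂ (Affine Φ hΦ hΦs) (⨂[ℂ] i, Eval (z i) (U i))
      (loopElt Φ hΦ hΦs a n)) := by
  rw [toEnd_loopElt_tensor]
  refine Commute.isNilpotent_sum (fun i _ => ?_) fun i j _ _ => ?_
  · obtain ⟨k, hk⟩ := ha i
    refine IsNilpotent.smul ⟨k, ?_⟩ _
    have hk' : evalOp z U i a ^ k = 0 := hk
    rw [← factorEnd_pow, hk', factorEnd_zero]
  · refine Commute.smul_left (Commute.smul_right ?_ _) _
    by_cases hij : i = j
    · subst hij
      exact Commute.refl _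
    · exact LinearMap.ext fun m => factorEnd_comm _ hij _ _ m

theorem sum_toEnd_loopElt_tensor (a : 𝔤) (j : ℤ) :
    ((∏ i, (Polynomial.X - Polynomial.C (z i : ℂ))).sum fun k c => c •
      LieModule.toEnd ℂ (Affine Φ hΦ hΦs) (⨂[ℂ] i, Eval (z i) (U i))
        (loopElt Φ hΦ hΦs a (j + k))) = 0 := by
  rw [Polynomial.sum_def]
  simp only [toEnd_loopElt_tensor, Finset.smul_sum, smul_smul]
  rw [Finset.sum_comm]
  refine Finset.sum_eq_zero fun i _ => ?_
  rw [← Finset.sum_smul]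
  have h : ∑ k ∈ (∏ i, (Polynomial.X - Polynomial.C (z i : ℂ))).support,
      (∏ i, (Polynomial.X - Polynomial.C (z i : ℂ))).coeff k * (z i : ℂ) ^ (j + ((k : ℕ) : ℤ)) =
        (z i : ℂ) ^ j * (∏ i, (Polynomial.X - Polynomial.C (z i : ℂ))).eval (z i : ℂ) := by
    rw [Polynomial.eval_eq_sum, Polynomial.sum_def, Finset.mul_sum]
    refine Finset.sum_congr rfl fun k _ => ?_
    rw [zpow_add₀ (z i).ne_zero, zpow_natCast]
    ring
  rw [h, Polynomial.eval_prod, Finset.prod_eq_zero (Finset.mem_univ i) (by simp), mul_zero,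
    zero_smul]

/-- A linear map commuting with the elements `a(n)` is a homomorphism if the central element acts
as zero. -/
theorem map_lie_of_loopElt {V W : Type*} [AddCommGroup V] [Module ℂ V]
    [LieRingModule (Affine Φ hΦ hΦs) V] [LieModule ℂ (Affine Φ hΦ hΦs) V] [AddCommGroup W]
    [Module ℂ W] [LieRingModule (Affine Φ hΦ hΦs) W] [LieModule ℂ (Affine Φ hΦ hΦs) W]
    (hV : LieModule.toEnd ℂ (Affine Φ hΦ hΦs) V (central Φ hΦ hΦs) = 0)
    (hW : LieModule.toEnd ℂ (Affine Φ hΦ hΦs) W (central Φ hΦ hΦs) = 0) (φ : V →ₗ[ℂ] W)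
    (h : ∀ a n v, φ ⁅loopElt Φ hΦ hΦs a n, v⁆ = ⁅loopElt Φ hΦ hΦs a n, φ v⁆)
    (x : Affine Φ hΦ hΦs) (v : V) : φ ⁅x, v⁆ = ⁅x, φ v⁆ := by
  have hx : x ∈ Submodule.span ℂ
      (insert (central Φ hΦ hΦs) {x | ∃ a n, loopElt Φ hΦ hΦs a n = x}) :=
    span_loopElt_central Φ hΦ hΦs ▸ Submodule.mem_top
  induction hx using Submodule.span_induction with
  | mem x hx =>
    rcases hx with rfl | ⟨a, n, rfl⟩
    · have h1 : ⁅central Φ hΦ hΦs, v⁆ = 0 := LinearMap.congr_fun hV v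
      have h2 : ⁅central Φ hΦ hΦs, φ v⁆ = 0 := LinearMap.congr_fun hW (φ v)
      rw [h1, h2, map_zero]
    · exact h a n v
  | zero => rw [zero_lie, zero_lie, map_zero]
  | add x y _ _ hx hy => rw [add_lie, add_lie, map_add, hx, hy]
  | smul c x _ hx => rw [smul_lie, smul_lie, map_smul, hx]

end Evaluation

/-! ### The category condition as a recurrence of operators -/

section CategoryE

variable {𝔤 : Type*} [LieRing 𝔤] [LieAlgebra ℂ 𝔤] [FiniteDimensional ℂ 𝔤]
  [LieAlgebra.IsSimple ℂ 𝔤]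
  (H : LieSubalgebra ℂ 𝔤) [H.IsCartanSubalgebra]
  (W : Type*) [AddCommGroup W] [Module ℂ W] [LieRingModule (StdAffine H) W]
  [LieModule ℂ (StdAffine H) W]

/-- The coefficient of `xʲ` in `p(x)a(x)w` is `∑ p_k a(-j-1+k) w`; the substitution `j ↦ -j - 1` is
its own inverse. -/
theorem inCategoryE_iff : InCategoryE H W ↔ ∃ p : Polynomial ℂ, p ≠ 0 ∧ ∀ (a : 𝔤) (j : ℤ),
    (p.sum fun k c => c • LieModule.toEnd ℂ (StdAffine H) W (elt H a (j + k))) = 0 := by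
  have e : ∀ (p : Polynomial ℂ) a j w, polyMul p (genFun H W a w) j =
      (p.sum fun k c => c • LieModule.toEnd ℂ (StdAffine H) W (elt H a ((-j - 1) + k))) w := by
    intro p a j w
    simp only [polyMul, genFun, Polynomial.sum_def, LinearMap.sum_apply, LinearMap.smul_apply,
      LieModule.toEnd_apply_apply]
    refine Finset.sum_congr rfl fun k _ => ?_
    rw [show -(j - (k : ℤ)) - 1 = -j - 1 + k by ring]
  refine exists_congr fun p => and_congr_right fun _ => ⟨fun h a j => ?_, fun h a w => ?_⟩
  · refine LinearMap.ext fun w => ?_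
    have h1 := congrFun (h a w) (-j - 1)
    rwa [e, show -(-j - 1) - 1 = j by ring] at h1
  · funext j
    rw [e, h]
    rfl

end CategoryE

/-! ### Invariance under isomorphism -/

section Transport

variable {𝔤 : Type*} [LieRing 𝔤] [LieAlgebra ℂ 𝔤] [FiniteDimensional ℂ 𝔤]
  [LieAlgebra.IsSimple ℂ 𝔤]
  (H : LieSubalgebra ℂ 𝔤) [H.IsCartanSubalgebra]
  {W V : Type*} [AddCommGroup W] [Module ℂ W] [LieRingModule (StdAffine H) W]
  [AddCommGroup V] [Module ℂ V] [LieRingModule (StdAffine H) V]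

theorem inCategoryE_of_equiv (φ : W ≃ₗ⁅ℂ, StdAffine H⁆ V) (h : InCategoryE H V) :
    InCategoryE H W := by
  obtain ⟨p, hp, h⟩ := h
  refine ⟨p, hp, fun a w => funext fun j => φ.injective ?_⟩
  have h1 := congrFun (h a (φ w)) j
  simp only [polyMul, genFun, Polynomial.sum_def] at h1 ⊢
  change (φ : W →ₗ[ℂ] V) _ = (φ : W →ₗ[ℂ] V) 0
  rw [map_sum, map_zero]
  refine Eq.trans (Finset.sum_congr rfl fun k _ => ?_) h1
  rw [map_smul]
  exact congrArg _ (φ.toLieModuleHom.map_lie _ _)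

theorem isIrreducible_of_equiv (φ : W ≃ₗ⁅ℂ, StdAffine H⁆ V)
    (h : LieModule.IsIrreducible ℂ (StdAffine H) V) :
    LieModule.IsIrreducible ℂ (StdAffine H) W := by
  have hV := LieModule.nontrivial_of_isIrreducible ℂ (StdAffine H) V
  have hW : Nontrivial W := φ.toLinearEquiv.toEquiv.nontrivial
  refine LieModule.IsIrreducible.mk fun N hN => ?_
  have h1 : N.map φ.toLieModuleHom ≠ ⊥ := by
    intro h0
    refine hN ((LieSubmodule.eq_bot_iff N).2 fun w hw => φ.injective ?_)
    have h2 : φ w ∈ N.map φ.toLieModuleHom := LieSubmodule.mem_map_of_mem hw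
    rw [h0, LieSubmodule.mem_bot] at h2
    exact h2.trans (map_zero (φ : W →ₗ[ℂ] V)).symm
  have h3 := (h.eq_bot_or_eq_top _).resolve_left h1
  refine eq_top_iff.2 fun w _ => ?_
  have h4 : φ w ∈ N.map φ.toLieModuleHom := h3 ▸ LieSubmodule.mem_top _
  obtain ⟨w', hw', h5⟩ := (LieSubmodule.mem_map _).1 h4
  exact φ.injective h5 ▸ hw'

variable [LieModule ℂ (StdAffine H) W] [LieModule ℂ (StdAffine H) V]

theorem isIntegrable_of_equiv (φ : W ≃ₗ⁅ℂ, StdAffine H⁆ V) (h : IsIntegrable H V) :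
    IsIntegrable H W := by
  intro α hα a ha n w
  obtain ⟨k, hk⟩ := h α hα a ha n (φ w)
  have h1 : LieModule.toEnd ℂ (StdAffine H) V (elt H a n) ∘ₗ (φ : W →ₗ[ℂ] V) =
      (φ : W →ₗ[ℂ] V) ∘ₗ LieModule.toEnd ℂ (StdAffine H) W (elt H a n) :=
    LinearMap.ext fun w => (φ.toLieModuleHom.map_lie (elt H a n) w).symm
  have h2 := LinearMap.congr_fun (Module.End.commute_pow_left_of_commute h1 k) w
  refine ⟨k, φ.injective ?_⟩
  exact (h2.symm.trans hk).trans (map_zero (φ : W →ₗ[ℂ] V)).symm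

end Transport

/-! ### Perfectness and spanning by root vectors and coroots -/

section Simple

variable {𝔤 : Type*} [LieRing 𝔤] [LieAlgebra ℂ 𝔤] [LieAlgebra.IsSimple ℂ 𝔤]

/-- A simple Lie algebra is perfect. -/
theorem span_lie_eq_top : Submodule.span ℂ {x | ∃ a b : 𝔤, ⁅a, b⁆ = x} = ⊤ := by
  have h : (⁅(⊤ : LieIdeal ℂ 𝔤), (⊤ : LieIdeal ℂ 𝔤)⁆ : LieIdeal ℂ 𝔤) = ⊤ := by
    refine (LieAlgebra.IsSimple.eq_bot_or_eq_top _).resolve_left fun h => ?_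
    refine LieAlgebra.IsSimple.non_abelian (R := ℂ) (L := 𝔤) ⟨fun a b => ?_⟩
    have h1 := LieSubmodule.lie_mem_lie (LieSubmodule.mem_top (R := ℂ) (L := 𝔤) a)
      (LieSubmodule.mem_top (R := ℂ) (L := 𝔤) b)
    rwa [h, LieSubmodule.mem_bot] at h1
  have h2 := congrArg LieSubmodule.toSubmodule h
  rw [LieSubmodule.lieIdeal_oper_eq_linear_span', LieSubmodule.top_toSubmodule] at h2
  simpa using h2

variable [FiniteDimensional ℂ 𝔤] (H : LieSubalgebra ℂ 𝔤) [H.IsCartanSubalgebra]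

/-- Root vectors and the semisimple elements of `𝔰𝔩₂`-triples of root vectors span. -/
theorem span_rootVectors_sl2Triples_eq_top {R : Set 𝔤}
    (hR : ∀ α ∈ H.root, ∀ a ∈ LieAlgebra.rootSpace H α, a ∈ R) :
    Submodule.span ℂ (R ∪ {h | ∃ e ∈ R, ∃ f ∈ R, IsSl2Triple h e f}) = ⊤ := by
  set S := Submodule.span ℂ (R ∪ {h | ∃ e ∈ R, ∃ f ∈ R, IsSl2Triple h e f})
  have hroot : ∀ α : LieModule.Weight ℂ H 𝔤, α.IsNonZero →
      (LieAlgebra.rootSpace H α).toSubmodule ≤ S := fun α hα a ha =>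
    Submodule.subset_span (Or.inl (hR α (by simpa using hα) a ha))
  have hcoroot : ∀ α : LieModule.Weight ℂ H 𝔤, α.IsNonZero →
      (LieAlgebra.IsKilling.coroot α : 𝔤) ∈ S := by
    intro α hα
    obtain ⟨h, e, f, ht, he, hf⟩ := LieAlgebra.IsKilling.exists_isSl2Triple_of_weight_isNonZero hα
    rw [← ht.h_eq_coroot hα he hf]
    refine Submodule.subset_span (Or.inr ⟨e, hR α (by simpa using hα) e he, f, ?_, ht⟩)
    exact hR (-α) (by simpa using hα) f (by simpa using hf)
  -- The coroots span the Cartan subalgebra, which is the zero root space.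
  have hcartan : H.toSubmodule ≤ S := by
    intro x hx
    have h1 : (⟨x, hx⟩ : H) ∈ Submodule.span ℂ (Set.range (LieAlgebra.IsKilling.rootSystem H).coroot) := by
      rw [RootPairing.IsRootSystem.span_coroot_eq_top]
      exact Submodule.mem_top
    refine Submodule.span_le (p := S.comap H.toSubmodule.subtype).2 ?_ h1
    rintro _ ⟨α, rfl⟩
    exact hcoroot α.1 (H.isNonZero_coe_root α)
  have h1 := congrArg LieSubmodule.toSubmodule (LieModule.iSup_genWeightSpace_eq_top' ℂ H 𝔤)
  rw [LieSubmodule.iSup_toSubmodule, LieSubmodule.top_toSubmodule] at h1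
  rw [eq_top_iff, ← h1]
  refine iSup_le fun α => ?_
  by_cases hα : α.IsZero
  · have h2 : (α : H → ℂ) = 0 := hα
    intro x hx
    rw [h2] at hx
    have h3 : x ∈ LieAlgebra.rootSpace H (0 : H → ℂ) := hx
    rw [LieAlgebra.rootSpace_zero_eq] at h3
    exact hcartan h3
  · exact hroot α hα

end Simple

/-! ### Coordinate representations as modules -/

section Realization

variable {𝔤 : Type*} [LieRing 𝔤] [LieAlgebra ℂ 𝔤]

universe v

/-- The module of an irreducible representation, in an arbitrary universe. -/
def IrrRep.Carrier (U : IrrRep 𝔤) : Type v := ULift.{v} (Fin U.dim → ℂ)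

variable (U : IrrRep 𝔤)

instance : AddCommGroup (IrrRep.Carrier.{v, _} U) :=
  inferInstanceAs (AddCommGroup (ULift.{v} (Fin U.dim → ℂ)))

instance : Module ℂ (IrrRep.Carrier.{v, _} U) :=
  inferInstanceAs (Module ℂ (ULift.{v} (Fin U.dim → ℂ)))

/-- The identification with the coordinate space. -/
def IrrRep.carrierEquiv : IrrRep.Carrier.{v, _} U ≃ₗ[ℂ] (Fin U.dim → ℂ) :=
  (ULift.moduleEquiv : ULift.{v} (Fin U.dim → ℂ) ≃ₗ[ℂ] (Fin U.dim → ℂ))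

instance : FiniteDimensional ℂ (IrrRep.Carrier.{v, _} U) :=
  U.carrierEquiv.symm.finiteDimensional

instance : LieRingModule 𝔤 (IrrRep.Carrier.{v, _} U) where
  bracket a u := U.carrierEquiv.symm (U.rep a (U.carrierEquiv u))
  add_lie a b u := by simp
  lie_add a u v := by simp
  leibniz_lie a b u := by simp [LieRing.of_associative_ring_bracket]

theorem IrrRep.carrierEquiv_lie (a : 𝔤) (u : IrrRep.Carrier.{v, _} U) :
    U.carrierEquiv ⁅a, u⁆ = U.rep a (U.carrierEquiv u) :=
  U.carrierEquiv.apply_symm_apply _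

instance : LieModule ℂ 𝔤 (IrrRep.Carrier.{v, _} U) where
  smul_lie c a u := U.carrierEquiv.injective (by simp [IrrRep.carrierEquiv_lie])
  lie_smul c a u := U.carrierEquiv.injective (by simp [IrrRep.carrierEquiv_lie])

theorem IrrRep.isIrreducible_carrier : LieModule.IsIrreducible ℂ 𝔤 (IrrRep.Carrier.{v, _} U) := by
  have : Nonempty (Fin U.dim) := Fin.pos_iff_nonempty.1 (Nat.pos_of_ne_zero U.dim_ne_zero)
  have : Nontrivial (IrrRep.Carrier.{v, _} U) := U.carrierEquiv.toEquiv.nontrivial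
  refine LieModule.IsIrreducible.mk fun N hN => ?_
  have h := U.irreducible (N.toSubmodule.map (U.carrierEquiv : _ →ₗ[ℂ] _)) (by
    rintro a _ ⟨u, hu, rfl⟩
    exact ⟨⁅a, u⁆, N.lie_mem hu, U.carrierEquiv_lie a u⟩)
  have hinj := Submodule.map_injective_of_injective
    (f := (U.carrierEquiv : IrrRep.Carrier.{v, _} U →ₗ[ℂ] (Fin U.dim → ℂ))) U.carrierEquiv.injective
  rcases h with h | h
  · refine absurd ?_ hN
    rw [← LieSubmodule.toSubmodule_eq_bot]
    exact hinj (h.trans (Submodule.map_bot _).symm)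
  · rw [← LieSubmodule.toSubmodule_eq_top]
    refine hinj (h.trans ?_)
    rw [Submodule.map_top, LinearMap.range_eq_top.2 U.carrierEquiv.surjective]

end Realization

/-! ### Irreducibility in terms of the loop operators -/

section LoopIrreducible

variable {𝔤 : Type*} [LieRing 𝔤] [LieAlgebra ℂ 𝔤]
  (Φ : LinearMap.BilinForm ℂ 𝔤) (hΦ : Φ.lieInvariant 𝔤) (hΦs : Φ.IsSymm)
  {W : Type*} [AddCommGroup W] [Module ℂ W] [LieRingModule (Affine Φ hΦ hΦs) W]
  [LieModule ℂ (Affine Φ hΦ hΦs) W]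

/-- A subspace stable under the elements `a(n)` is a submodule if the central element acts as
zero. -/
theorem lie_mem_of_loopElt
    (hc : LieModule.toEnd ℂ (Affine Φ hΦ hΦs) W (central Φ hΦ hΦs) = 0) (N : Submodule ℂ W)
    (h : ∀ a n, ∀ w ∈ N, ⁅loopElt Φ hΦ hΦs a n, w⁆ ∈ N)
    (x : Affine Φ hΦ hΦs) {w : W} (hw : w ∈ N) : ⁅x, w⁆ ∈ N := by
  have hx : x ∈ Submodule.span ℂ
      (insert (central Φ hΦ hΦs) {x | ∃ a n, loopElt Φ hΦ hΦs a n = x}) :=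
    span_loopElt_central Φ hΦ hΦs ▸ Submodule.mem_top
  induction hx using Submodule.span_induction with
  | mem x hx =>
    rcases hx with rfl | ⟨a, n, rfl⟩
    · have h1 : ⁅central Φ hΦ hΦs, w⁆ = 0 := LinearMap.congr_fun hc w
      rw [h1]
      exact N.zero_mem
    · exact h a n w hw
  | zero => rw [zero_lie]; exact N.zero_mem
  | add x y _ _ hx hy => rw [add_lie]; exact N.add_mem hx hy
  | smul c x _ hx => rw [smul_lie]; exact N.smul_mem c hx

theorem isLoopIrreducible_loopAct
    (hc : LieModule.toEnd ℂ (Affine Φ hΦ hΦs) W (central Φ hΦ hΦs) = 0)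
    (hW : LieModule.IsIrreducible ℂ (Affine Φ hΦ hΦs) W) :
    IsLoopIrreducible (loopAct Φ hΦ hΦs W) := by
  intro N hN
  let N' : LieSubmodule ℂ (Affine Φ hΦ hΦs) W :=
    { N with
      lie_mem := fun {x _} hw => lie_mem_of_loopElt Φ hΦ hΦs hc N
        (fun a n w hw => hN (LaurentPolynomial.T n) a w hw) x hw }
  exact (hW.eq_bot_or_eq_top N').imp (congrArg LieSubmodule.toSubmodule)
    (congrArg LieSubmodule.toSubmodule)

end LoopIrreducible

/-! ### Classification -/

section Classification

universe v

variable {𝔤 : Type*} [LieRing 𝔤] [LieAlgebra ℂ 𝔤] [FiniteDimensional ℂ 𝔤]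
  [LieAlgebra.IsSimple ℂ 𝔤]
  (H : LieSubalgebra ℂ 𝔤) [H.IsCartanSubalgebra]
  (W : Type*) [AddCommGroup W] [Module ℂ W] [LieRingModule (StdAffine H) W]
  [LieModule ℂ (StdAffine H) W]

/-- An irreducible module is a quotient of an evaluation module, hence isomorphic to it, if it
admits a nonzero equivariant multilinear map. -/
theorem nonempty_equiv_of_multilinearMap {r : ℕ} {z : Fin r → ℂˣ} (hz : Function.Injective z)
    (U : Fin r → IrrRep 𝔤) (hW : LieModule.IsIrreducible ℂ (StdAffine H) W)
    (hc : LieModule.toEnd ℂ (StdAffine H) W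
      (central (normForm H) (normForm_lieInvariant H) (normForm_isSymm H)) = 0)
    (ρ : Fin r → 𝔤 →ₗ⁅ℂ⁆ Module.End ℂ W)
    (hρ : ∀ (a : 𝔤) (n : ℤ), LieModule.toEnd ℂ (StdAffine H) W (elt H a n) =
      ∑ i, ((z i : ℂ) ^ n) • ρ i a)
    (F : MultilinearMap ℂ (fun i => Fin (U i).dim → ℂ) W) (hF0 : F ≠ 0)
    (hF : ∀ i a u, F (Function.update u i ((U i).rep a (u i))) = ρ i a (F u)) :
    Nonempty (W ≃ₗ⁅ℂ, StdAffine H⁆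
      (PiTensorProduct ℂ fun i => Eval (z i) (IrrRep.Carrier.{v, _} (U i)))) := by
  let e : ∀ i, Eval (z i) (IrrRep.Carrier.{v, _} (U i)) ≃ₗ[ℂ] (Fin (U i).dim → ℂ) := fun i =>
    (U i).carrierEquiv
  have he : ∀ i a u, e i (evalOp z (fun i => IrrRep.Carrier.{v, _} (U i)) i a u) =
      (U i).rep a (e i u) := fun i a u => (U i).carrierEquiv_lie a u
  let G := F.compLinearMap fun i => (e i).toLinearMap
  have hG : ∀ i a u, G (Function.update u i
      (evalOp z (fun i => IrrRep.Carrier.{v, _} (U i)) i a (u i))) = ρ i a (G u) := by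
    intro i a u
    have h1 : (fun j => e j (Function.update u i
        (evalOp z (fun i => IrrRep.Carrier.{v, _} (U i)) i a (u i)) j)) =
        Function.update (fun j => e j (u j)) i ((U i).rep a (e i (u i))) := by
      funext j
      by_cases hj : j = i
      · subst hj
        simp [he]
      · simp [hj]
    exact (congrArg F h1).trans (hF i a fun j => e j (u j))
  let φ := PiTensorProduct.lift G
  have hφ : ∀ i a m, φ (factorEnd (fun i => Eval (z i) (IrrRep.Carrier.{v, _} (U i))) i
      (evalOp z (fun i => IrrRep.Carrier.{v, _} (U i)) i a) m) = ρ i a (φ m) := by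
    intro i a m
    refine LinearMap.congr_fun (f := φ ∘ₗ factorEnd _ i _) (g := ρ i a ∘ₗ φ)
      (PiTensorProduct.ext (MultilinearMap.ext fun u => ?_)) m
    simp only [LinearMap.compMultilinearMap_apply, LinearMap.comp_apply, factorEnd_tprod, φ,
      PiTensorProduct.lift.tprod, hG]
  have hlie := map_lie_of_loopElt _ _ _
    (toEnd_central_tensor (normForm H) (normForm_lieInvariant H) (normForm_isSymm H) z
      fun i => IrrRep.Carrier.{v, _} (U i)) hc φ (by
      intro a n m
      have h1 := LinearMap.congr_fun (toEnd_loopElt_tensor (normForm H) (normForm_lieInvariant H)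
        (normForm_isSymm H) z (fun i => IrrRep.Carrier.{v, _} (U i)) a n) m
      have h2 := LinearMap.congr_fun (hρ a n) (φ m)
      refine (congrArg φ h1).trans (Eq.trans ?_ h2.symm)
      simp only [LinearMap.sum_apply, LinearMap.smul_apply, map_sum, map_smul, hφ])
  let ψ : (PiTensorProduct ℂ fun i => Eval (z i) (IrrRep.Carrier.{v, _} (U i))) →ₗ⁅ℂ, StdAffine H⁆ W :=
    { φ with map_lie' := fun {x m} => hlie x m }
  have hT := isIrreducible_tensor (normForm H) (normForm_lieInvariant H) (normForm_isSymm H) z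
    (fun i => IrrRep.Carrier.{v, _} (U i)) (fun i => (U i).isIrreducible_carrier) hz
  have hψ0 : ψ ≠ 0 := by
    intro h0
    refine hF0 (MultilinearMap.ext fun u => ?_)
    have h1 : G (fun i => (e i).symm (u i)) = 0 := by
      rw [← PiTensorProduct.lift.tprod (φ := G)]
      exact congrArg (fun f => f (PiTensorProduct.tprod ℂ fun i => (e i).symm (u i))) h0
    simpa [G] using h1
  have hker : ψ.ker = ⊥ := (hT.eq_bot_or_eq_top _).resolve_right fun h => hψ0 (by
    ext m
    have : m ∈ ψ.ker := h ▸ LieSubmodule.mem_top m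
    simpa using this)
  have hrange : ψ.range = ⊤ := (hW.eq_bot_or_eq_top _).resolve_left fun h => hψ0 (by
    ext m
    have : ψ m ∈ ψ.range := ψ.mem_range _ |>.2 ⟨m, rfl⟩
    rw [h] at this
    simpa using this)
  have hbij : Function.Bijective ψ :=
    ⟨(LieModuleHom.ker_eq_bot ψ).1 hker, (LieModuleHom.range_eq_top ψ).1 hrange⟩
  exact ⟨LieModuleEquiv.symm
    { ψ with
      invFun := (Equiv.ofBijective ψ hbij).symm
      left_inv := (Equiv.ofBijective ψ hbij).symm_apply_apply
      right_inv := (Equiv.ofBijective ψ hbij).apply_symm_apply }⟩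

theorem exists_equiv_tensor_of_isIrreducible (hW : LieModule.IsIrreducible ℂ (StdAffine H) W)
    (hint : IsIntegrable H W) (hE : InCategoryE H W) :
    ∃ (r : ℕ) (_ : 1 ≤ r) (U : Fin r → IrrRep 𝔤) (z : Fin r → ℂˣ), Function.Injective z ∧
      Nonempty (W ≃ₗ⁅ℂ, StdAffine H⁆
        (PiTensorProduct ℂ fun i => Eval (z i) (IrrRep.Carrier.{v, _} (U i)))) := by
  have hWn := LieModule.nontrivial_of_isIrreducible ℂ (StdAffine H) W
  obtain ⟨p, hp, hrec⟩ := (inCategoryE_iff H W).1 hE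
  have hc := toEnd_central_eq_zero (normForm H) (normForm_lieInvariant H) (normForm_isSymm H)
    (normForm_ne_zero H) hp hrec
  set θ := loopAct (normForm H) (normForm_lieInvariant H) (normForm_isSymm H) W with hθdef
  have hθ : IsLoopRep θ := loopAct_lie_loopAct _ _ _ hc
  have hperf := span_lie_eq_top (𝔤 := 𝔤)
  have hirr : IsLoopIrreducible θ := isLoopIrreducible_loopAct _ _ _ hc hW
  have hLfin := finiteDimensional_loopRange (θ := θ) hp hrec
  have hWfin : FiniteDimensional ℂ W := by
    refine finiteDimensional_of_span_locallyNilpotent hθ hirr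
      (span_locallyNilpotent_eq_loopRange hθ
        (R := {e | ∃ α ∈ H.root, e ∈ LieAlgebra.rootSpace H α}) ?_
        (span_rootVectors_sl2Triples_eq_top H fun α hα a ha => ⟨α, hα, ha⟩))
    rintro e ⟨α, hα, he⟩ n
    exact hint α hα e he n
  have hI : (vanishingIdeal hθ hperf).IsRadical :=
    (Ideal.isRadical_iff_pow_one_lt 2 one_lt_two).2 fun f hf =>
      eq_zero_of_mul_self_eq_zero hθ hperf hirr (by rw [← pow_two]; exact hf)
  have hpI : p.toLaurent ∈ vanishingIdeal hθ hperf := by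
    change θ p.toLaurent = 0
    refine LinearMap.ext fun a => ?_
    rw [toLaurent_eq_sum, Polynomial.sum_def, map_sum, LinearMap.sum_apply]
    have h := hrec a 0
    simpa [Polynomial.sum_def, hθdef, loopAct_T] using h
  obtain ⟨r, hr, z, hz, hzI⟩ := exists_points_of_ne_zero hI hp hpI
  obtain ⟨U, F, hF0, hF⟩ := exists_equivariant_multilinearMap r W (pointRep hθ hperf hz hzI)
    fun i j hij a b => commute_pointRep hθ hperf hz hzI hij a b
  exact ⟨r, hr, U, z, hz, nonempty_equiv_of_multilinearMap H W hz U hW hc _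
    (fun a n => apply_T_eq_sum_pointRep hθ hperf hz hzI n a) F hF0 hF⟩

theorem isIntegrable_tensor {r : ℕ} (z : Fin r → ℂˣ) (U : Fin r → Type*)
    [∀ i, AddCommGroup (U i)] [∀ i, Module ℂ (U i)] [∀ i, LieRingModule 𝔤 (U i)]
    [∀ i, LieModule ℂ 𝔤 (U i)] [∀ i, FiniteDimensional ℂ (U i)] :
    IsIntegrable H (PiTensorProduct ℂ fun i => Eval (z i) (U i)) := by
  intro α hα a ha n w
  have hα' : (α : H → ℂ) ≠ 0 := by
    -- A vector of a nonzero root space shifts weights and is therefore nilpotent on each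
    -- finite-dimensional `U i`.
    have : α.IsNonZero := by simpa using hα
    exact this
  obtain ⟨k, hk⟩ := isNilpotent_toEnd_loopElt_tensor (normForm H) (normForm_lieInvariant H)
    (normForm_isSymm H) z U
    (fun i => LieModule.isNilpotent_toEnd_of_mem_rootSpace (M := U i) H hα' ha) n
  exact ⟨k, LinearMap.congr_fun hk w⟩

theorem inCategoryE_tensor {r : ℕ} (z : Fin r → ℂˣ) (U : Fin r → Type*)
    [∀ i, AddCommGroup (U i)] [∀ i, Module ℂ (U i)] [∀ i, LieRingModule 𝔤 (U i)]
    [∀ i, LieModule ℂ 𝔤 (U i)] :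
    InCategoryE H (PiTensorProduct ℂ fun i => Eval (z i) (U i)) :=
  (inCategoryE_iff H _).2 ⟨_, Finset.prod_ne_zero_iff.2 fun _ _ => Polynomial.X_sub_C_ne_zero _,
    sum_toEnd_loopElt_tensor _ _ _ z U⟩

end Classification

end AffineLie

end

/-- A module `W` over the standard affine Lie algebra of `𝔤` is irreducible, integrable and in the
category `ℰ` if and only if it is isomorphic to an evaluation module `U₁(z₁) ⊗ ⋯ ⊗ Uᵣ(zᵣ)`. -/
theorem proposition3p21 {𝔤 : Type*} [LieRing 𝔤] [LieAlgebra ℂ 𝔤]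
    [FiniteDimensional ℂ 𝔤] [LieAlgebra.IsSimple ℂ 𝔤]
    (H : LieSubalgebra ℂ 𝔤) [H.IsCartanSubalgebra]
    (W : Type*) [AddCommGroup W] [Module ℂ W] [LieRingModule (AffineLie.StdAffine H) W]
    [LieModule ℂ (AffineLie.StdAffine H) W] :
    (LieModule.IsIrreducible ℂ (AffineLie.StdAffine H) W ∧
        AffineLie.IsIntegrable H W ∧ AffineLie.InCategoryE H W) ↔
      ∃ (r : ℕ) (_ : 1 ≤ r) (U : Fin r → Type*) (_ : ∀ i, AddCommGroup (U i))
        (_ : ∀ i, Module ℂ (U i)) (_ : ∀ i, LieRingModule 𝔤 (U i))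
        (_ : ∀ i, LieModule ℂ 𝔤 (U i)) (z : Fin r → ℂˣ),
        (∀ i, FiniteDimensional ℂ (U i)) ∧
        (∀ i, LieModule.IsIrreducible ℂ 𝔤 (U i)) ∧
        Function.Injective z ∧
        Nonempty (W ≃ₗ⁅ℂ, AffineLie.StdAffine H⁆
          (PiTensorProduct ℂ fun i => AffineLie.Eval (z i) (U i))) := by
  constructor
  · rintro ⟨hW, hint, hE⟩
    obtain ⟨r, hr, U, z, hz, e⟩ :=
      AffineLie.exists_equiv_tensor_of_isIrreducible H W hW hint hE
    exact ⟨r, hr, fun i => (U i).Carrier, fun _ => inferInstance, fun _ => inferInstance,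
      fun _ => inferInstance, fun _ => inferInstance, z, fun _ => inferInstance,
      fun i => (U i).isIrreducible_carrier, hz, e⟩
  · rintro ⟨r, -, U, _, _, _, _, z, _, hU, hz, ⟨e⟩⟩
    exact ⟨AffineLie.isIrreducible_of_equiv H e (AffineLie.isIrreducible_tensor _ _ _ z U hU hz),
      AffineLie.isIntegrable_of_equiv H e (AffineLie.isIntegrable_tensor H z U),
      AffineLie.inCategoryE_of_equiv H e (AffineLie.inCategoryE_tensor H z U)⟩
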